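/- Identify $\mathbb{R}^8=\mathbb{R}^4_x\oplus\mathbb{R}^4_y$ with $\mathbb{H}^2$ via $x=x^0-x^1\mathbf i-x^2\mathbf j-x^3\mathbf k$, $y=y^0-y^1\mathbf i-y^2\mathbf j-y^3\mathbf k$, and let $I_1,I_2,I_3$ be right multiplication by $-\mathbf i,-\mathbf j,-\mathbf k$. Let $$\Psi_0=dx^{0123}+dy^{0123}+\omega_1^x\wedge\omega_1^y+\omega_2^x\wedge\omega_2^y-\omega_3^x\wedge\omega_3^y,$$ $$\omega^x_1=dx^{01}+dx^{23},\quad \omega^x_2=dx^{02}-dx^{13},\quad \omega^x_3=dx^{03}+dx^{12}\quad(\text{and similarly } \omega^y_i),$$ and give $S^7$ its round metric and standard $G_2$-structure $\phi=(\vec r\,\lrcorner\,\Psi_0)|_{S^7}$, with dual 4-form $\psi=\Psi_0|_{S^7}$. Let $$W=\left\{\begin{pmatrix}a&\bar z\\ z&-a\end{pmatrix}: a\in\mathbb{R},\ z\in\mathbb{H}\right\}$$ (the 5-dimensional irreducible representation of $\mathrm{Sp}(2)$), acting on $\mathbb{H}^2$ by left multiplication. For a connection $A$ on a bundle $E$ over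 $\mathbb{R}^8\setminus\{0\}$ and a real $8\times 8$ matrix $M$, put $X_M=M\vec r$ and $\alpha_M=X_M\,\lrcorner\,F_A\in\Omega^1(\mathfrak g_E)$. On $S^7$, let $$\mathscr L_A(u,\alpha)=\bigl(D_A^*\alpha,\ D_Au+*(\psi\wedge D_A\alpha)\bigr)$$ for $(u,\alpha)\in\Omega^0(\mathfrak g_E)\oplus\Omega^1(\mathfrak g_E)$, and write $\alpha\in\ker\mathscr L_A$ if $\mathscr L_A(0,\alpha)=0$. Let $A$ be a conical connection on $\mathbb{R}^8\setminus\{0\}$ (the pullback of a smooth connection over $S^7$ under radial projection) whose curvature takes values in $\mathrm{Lie}(\mathrm{Sp}(2))\otimes\mathfrak g_E$, where $\mathrm{Lie}(\mathrm{Sp}(2))\subset\Lambda^2\mathbb{R}^8$, and spans $\mathrm{Lie}(\mathrm{Sp}(2))$ as the point varies over $\mathbb{R}^8\setminus\{0\}$. Then the forms $\alpha_M$ with $M\in W\oplus WI_1\oplus WI_2$, restricted to $S^7$, form a 15-dimensional subspace of $\ker\mathscr L_A$, and this subspace is in Coulomb gauge, i.e. $D_A^*\alpha_M=0$ on $S^7$.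 In particular, this holds for the standard $G_2$-instanton $A_0$, the pullback by the right Hopf fibration $S^7\to S^4$ of the standard anti-self-dual instanton; in a suitable trivialization over $\{x\neq0,\ y\neq0\}$ it is given by $$A_0(x,y)=\frac{1}{|x|^2+|y|^2}\,\mathrm{Im}\bigl[\,|y|^2x^{-1}dx+|x|^2y^{-1}dy\,\bigr].$$ -/

import Mathlib

open scoped ContDiff Quaternion

noncomputable section

namespace G2Inst

/-! ### Euclidean 8-space as a quaternionic plane -/

/-- `ℝ⁸ = ℝ⁴_x ⊕ ℝ⁴_y`, with coordinates `x⁰, x¹, x², x³, y⁰, y¹, y², y³`. -/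
abbrev E8 : Type := EuclideanSpace ℝ (Fin 8)

/-- The standard basis of `ℝ⁸`. -/
def e (a : Fin 8) : E8 := EuclideanSpace.single a 1

/-- The quaternion `x = x⁰ - x¹ i - x² j - x³ k`. -/
def qx : E8 →L[ℝ] ℍ := LinearMap.toContinuousLinearMap
  { toFun := fun p => ⟨p 0, -p 1, -p 2, -p 3⟩
    map_add' := fun _ _ => Quaternion.ext _ _ rfl (neg_add _ _) (neg_add _ _) (neg_add _ _)
    map_smul' := fun _ _ => Quaternion.ext _ _ rfl (mul_neg _ _).symm (mul_neg _ _).symm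
      (mul_neg _ _).symm }

/-- The quaternion `y = y⁰ - y¹ i - y² j - y³ k`. -/
def qy : E8 →L[ℝ] ℍ := LinearMap.toContinuousLinearMap
  { toFun := fun p => ⟨p 4, -p 5, -p 6, -p 7⟩
    map_add' := fun _ _ => Quaternion.ext _ _ rfl (neg_add _ _) (neg_add _ _) (neg_add _ _)
    map_smul' := fun _ _ => Quaternion.ext _ _ rfl (mul_neg _ _).symm (mul_neg _ _).symm
      (mul_neg _ _).symm }

/-- The point of `ℝ⁸` with quaternionic coordinates `(x, y)`. -/
def ofQuat : ℍ × ℍ →L[ℝ] E8 := LinearMap.toContinuousLinearMap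
  { toFun := fun q => !₂[q.1.re, -q.1.imI, -q.1.imJ, -q.1.imK,
      q.2.re, -q.2.imI, -q.2.imJ, -q.2.imK]
    map_add' := fun p q => by ext i; fin_cases i <;> simp <;> ring
    map_smul' := fun t p => by ext i; fin_cases i <;> simp }

theorem qx_ofQuat (q : ℍ × ℍ) : qx (ofQuat q) = q.1 := by
  exact Quaternion.ext _ _ rfl (neg_neg _) (neg_neg _) (neg_neg _)

theorem qy_ofQuat (q : ℍ × ℍ) : qy (ofQuat q) = q.2 := by
  exact Quaternion.ext _ _ rfl (neg_neg _) (neg_neg _) (neg_neg _)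

theorem ofQuat_qx_qy (p : E8) : ofQuat (qx p, qy p) = p := by
  ext i
  fin_cases i
  · exact rfl
  · exact neg_neg (p 1)
  · exact neg_neg (p 2)
  · exact neg_neg (p 3)
  · exact rfl
  · exact neg_neg (p 5)
  · exact neg_neg (p 6)
  · exact neg_neg (p 7)

/-- The endomorphism of `ℍ²` given by left multiplication of column vectors by the quaternionic
matrix with rows `(a, b)` and `(c, d)`. -/
def quatMatrix (a b c d : ℍ) : E8 →L[ℝ] E8 := LinearMap.toContinuousLinearMap
  { toFun := fun p => ofQuat (a * qx p + b * qy p, c * qx p + d * qy p)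
    map_add' := fun p q => by
      rw [← map_add]; congr 1; ext1 <;> simp only [map_add, Prod.mk_add_mk] <;> noncomm_ring
    map_smul' := fun t p => by
      rw [RingHom.id_apply, ← map_smul]
      congr 1
      ext1 <;> simp [smul_add] }

/-- Right multiplication by the quaternion `q` on `ℍ²`. -/
def rightMul (q : ℍ) : E8 →L[ℝ] E8 := LinearMap.toContinuousLinearMap
  { toFun := fun p => ofQuat (qx p * q, qy p * q)
    map_add' := fun p p' => by
      rw [← map_add]; congr 1; ext1 <;> simp [add_mul]
    map_smul' := fun t p => by
      rw [RingHom.id_apply, ← map_smul]; congr 1; ext1 <;> simp }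

/-- The complex structure `I₁`: right multiplication by `-i`. -/
def I₁ : E8 →L[ℝ] E8 := rightMul ⟨0, -1, 0, 0⟩

/-- The complex structure `I₂`: right multiplication by `-j`. -/
def I₂ : E8 →L[ℝ] E8 := rightMul ⟨0, 0, -1, 0⟩

/-- The complex structure `I₃`: right multiplication by `-k`. -/
def I₃ : E8 →L[ℝ] E8 := rightMul ⟨0, 0, 0, -1⟩

/-- The space `W` of traceless self-adjoint `2 × 2` quaternionic matrices, with rows `(a, z̄)` and
`(z, -a)` for `a` real and `z` a quaternion, acting on `ℝ⁸ = ℍ²` from the left. -/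
def W : Submodule ℝ (E8 →L[ℝ] E8) where
  carrier := {M | ∃ (a : ℝ) (z : ℍ), M = quatMatrix (a : ℍ) (star z) z (-(a : ℍ))}
  zero_mem' := ⟨0, 0, by ext p : 1; simp [quatMatrix]; exact (map_zero ofQuat).symm⟩
  add_mem' := by
    rintro _ _ ⟨a, z, rfl⟩ ⟨b, w, rfl⟩
    refine ⟨a + b, z + w, ?_⟩
    ext p : 1
    simp only [quatMatrix, add_apply, LinearMap.coe_toContinuousLinearMap',
      LinearMap.coe_mk, AddHom.coe_mk]
    rw [← map_add]; congr 1
    ext1 <;> simp only [Prod.mk_add_mk, star_add, Quaternion.coe_add] <;> noncomm_ring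
  smul_mem' := by
    rintro t _ ⟨a, z, rfl⟩
    refine ⟨t * a, t • z, ?_⟩
    ext p : 1
    simp only [quatMatrix, smul_apply, LinearMap.coe_toContinuousLinearMap',
      LinearMap.coe_mk, AddHom.coe_mk]
    rw [← map_smul]; congr 1
    ext1 <;> simp only [Prod.smul_mk, Quaternion.coe_mul, Quaternion.star_smul, smul_mul_assoc, smul_add,
      Quaternion.coe_mul_eq_smul, neg_mul, smul_neg]

/-- The space `W J = {M ∘ J | M ∈ W}` for an endomorphism `J`. -/
def WMul (J : E8 →L[ℝ] E8) : Submodule ℝ (E8 →L[ℝ] E8) :=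
  W.map ((ContinuousLinearMap.compL ℝ E8 E8 E8).flip J).toLinearMap

/-- The space `W ⊕ W I₁ ⊕ W I₂` of endomorphisms of `ℝ⁸`. -/
def W₁₂ : Submodule ℝ (E8 →L[ℝ] E8) := W ⊔ WMul I₁ ⊔ WMul I₂

/-- `Lie(Sp(2)) ⊂ Λ² ℝ⁸`: the 2-forms `η(u, v) = ⟪m u, v⟫` with `m` skew-adjoint and linear over
`I₁, I₂, I₃`. -/
def lieSp2 : Submodule ℝ (E8 → E8 → ℝ) where
  carrier := {η | ∃ m : E8 →L[ℝ] E8, ContinuousLinearMap.adjoint m = -m ∧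
    m.comp I₁ = I₁.comp m ∧ m.comp I₂ = I₂.comp m ∧ m.comp I₃ = I₃.comp m ∧ η = fun u v => inner ℝ (m u) v}
  zero_mem' := ⟨0, by simp, by simp, by simp, by simp, by ext; simp⟩
  add_mem' := by
    rintro _ _ ⟨m, h0, h1, h2, h3, rfl⟩ ⟨m', h0', h1', h2', h3', rfl⟩
    refine ⟨m + m', by rw [map_add, h0, h0']; abel, by rw [ContinuousLinearMap.add_comp, ContinuousLinearMap.comp_add, h1, h1'],
      by rw [ContinuousLinearMap.add_comp, ContinuousLinearMap.comp_add, h2, h2'], by rw [ContinuousLinearMap.add_comp, ContinuousLinearMap.comp_add, h3, h3'], ?_⟩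
    ext u v
    simp [inner_add_left]
  smul_mem' := by
    rintro t _ ⟨m, h0, h1, h2, h3, rfl⟩
    refine ⟨t • m, by rw [map_smulₛₗ, h0]; simp, by rw [ContinuousLinearMap.smul_comp, ContinuousLinearMap.comp_smul, h1],
      by rw [ContinuousLinearMap.smul_comp, ContinuousLinearMap.comp_smul, h2], by rw [ContinuousLinearMap.smul_comp, ContinuousLinearMap.comp_smul, h3], ?_⟩
    ext u v
    simp [inner_smul_left]

/-! ### The standard `G₂`-structure on the 7-sphere -/

/-- `(dxᵃ ∧ dxᵇ)(u, v)`. -/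
def dx2 (a b : Fin 8) (u v : E8) : ℝ := u a * v b - u b * v a

/-- `(dxᵃ ∧ dxᵇ ∧ dxᶜ ∧ dxᵈ)(v₀, v₁, v₂, v₃)`. -/
def dx4 (a b c d : Fin 8) (v₀ v₁ v₂ v₃ : E8) : ℝ :=
  Matrix.det !![v₀ a, v₀ b, v₀ c, v₀ d; v₁ a, v₁ b, v₁ c, v₁ d;
    v₂ a, v₂ b, v₂ c, v₂ d; v₃ a, v₃ b, v₃ c, v₃ d]

/-- The wedge product of two 2-forms. -/
def wedge22 (α β : E8 → E8 → ℝ) (v₀ v₁ v₂ v₃ : E8) : ℝ :=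
  α v₀ v₁ * β v₂ v₃ - α v₀ v₂ * β v₁ v₃ + α v₀ v₃ * β v₁ v₂
    + α v₁ v₂ * β v₀ v₃ - α v₁ v₃ * β v₀ v₂ + α v₂ v₃ * β v₀ v₁

/-- The standard self-dual forms on `ℝ⁴_x`. -/
def ωx₁ (u v : E8) : ℝ := dx2 0 1 u v + dx2 2 3 u v
/-- The standard self-dual forms on `ℝ⁴_x`. -/
def ωx₂ (u v : E8) : ℝ := dx2 0 2 u v - dx2 1 3 u v
/-- The standard self-dual forms on `ℝ⁴_x`. -/
def ωx₃ (u v : E8) : ℝ := dx2 0 3 u v + dx2 1 2 u v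
/-- The standard self-dual forms on `ℝ⁴_y`. -/
def ωy₁ (u v : E8) : ℝ := dx2 4 5 u v + dx2 6 7 u v
/-- The standard self-dual forms on `ℝ⁴_y`. -/
def ωy₂ (u v : E8) : ℝ := dx2 4 6 u v - dx2 5 7 u v
/-- The standard self-dual forms on `ℝ⁴_y`. -/
def ωy₃ (u v : E8) : ℝ := dx2 4 7 u v + dx2 5 6 u v

/-- The 4-form `Ψ₀ = dx⁰¹²³ + dy⁰¹²³ + ω₁ˣ ∧ ω₁ʸ + ω₂ˣ ∧ ω₂ʸ - ω₃ˣ ∧ ω₃ʸ` on `ℝ⁸`. -/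
def Psi0 (v₀ v₁ v₂ v₃ : E8) : ℝ :=
  dx4 0 1 2 3 v₀ v₁ v₂ v₃ + dx4 4 5 6 7 v₀ v₁ v₂ v₃ + wedge22 ωx₁ ωy₁ v₀ v₁ v₂ v₃
    + wedge22 ωx₂ ωy₂ v₀ v₁ v₂ v₃ - wedge22 ωx₃ ωy₃ v₀ v₁ v₂ v₃

/-- The standard `G₂`-structure `φ = r ⌟ Ψ₀` of the unit sphere, at the point `p`. -/
def phiStd (p u v w : E8) : ℝ := Psi0 p u v w

/-! ### Connections and forms with values in the adjoint bundle

A bundle with connection over `S⁷` is described by local data in trivializations. Every object on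
`S⁷` is identified with its pullback to `ℝ⁸ ∖ {0}` under radial projection `p ↦ p / ‖p‖`: the
`k`-forms on (an open subset of) `S⁷` are exactly the `k`-forms on the cone over it that are
invariant under the dilations `p ↦ t p`, `t > 0`, and annihilated by the radial vector field. -/

/-- A closed subgroup of the group of units of an associative algebra (such as a matrix algebra),
together with its Lie algebra. -/
structure LinearLieGroup (𝔸 : Type*) [NormedRing 𝔸] [NormedAlgebra ℝ 𝔸] where
  group : Subgroup 𝔸ˣ
  isClosed : IsClosed (group : Set 𝔸ˣ)
  lie : Submodule ℝ 𝔸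
  commutator_mem : ∀ X ∈ lie, ∀ Y ∈ lie, X * Y - Y * X ∈ lie
  mem_lie : ∀ X : 𝔸, X ∈ lie ↔ ∀ t : ℝ, ∃ u ∈ group, (u : 𝔸) = NormedSpace.exp (t • X)

/-- A conical connection on `ℝ⁸ ∖ {0}`, with structure group `G`: the pullback of a smooth
connection on a `G`-bundle over `S⁷`. The bundle is given by transition functions `g i j` over a
cover by open cones `U i`, and the connection by its connection matrices `A i`, with
`A i = g A j g⁻¹ - dg g⁻¹` for `g = g i j`. -/
structure ConicalConnection {𝔸 : Type*} [NormedRing 𝔸] [NormedAlgebra ℝ 𝔸]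
    (G : LinearLieGroup 𝔸) (ι : Type*) where
  U : ι → Set E8
  isOpen_U : ∀ i, IsOpen (U i)
  zero_notMem_U : ∀ i, (0 : E8) ∉ U i
  cover : ∀ p : E8, p ≠ 0 → ∃ i, p ∈ U i
  cone : ∀ i, ∀ p ∈ U i, ∀ t : ℝ, 0 < t → t • p ∈ U i
  g : ι → ι → E8 → 𝔸ˣ
  g_mem : ∀ i j, ∀ p ∈ U i ∩ U j, g i j p ∈ G.group
  g_smooth : ∀ i j, ContDiffOn ℝ ∞ (fun p => (g i j p : 𝔸)) (U i ∩ U j)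
  g_cocycle : ∀ i j k, ∀ p ∈ U i ∩ U j ∩ U k, g i j p * g j k p = g i k p
  g_conical : ∀ i j, ∀ p ∈ U i ∩ U j, ∀ t : ℝ, 0 < t → g i j (t • p) = g i j p
  A : ι → E8 → E8 →L[ℝ] 𝔸
  A_smooth : ∀ i, ContDiffOn ℝ ∞ (A i) (U i)
  A_mem : ∀ i, ∀ p ∈ U i, ∀ v, A i p v ∈ G.lie
  A_radial : ∀ i, ∀ p ∈ U i, A i p p = 0
  A_conical : ∀ i, ∀ p ∈ U i, ∀ t : ℝ, 0 < t → t • A i (t • p) = A i p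
  A_gauge : ∀ i j, ∀ p ∈ U i ∩ U j, ∀ v, A i p v =
    (g i j p : 𝔸) * A j p v * ((g i j p)⁻¹ : 𝔸ˣ)
      - fderiv ℝ (fun q => (g i j q : 𝔸)) p v * ((g i j p)⁻¹ : 𝔸ˣ)

namespace ConicalConnection

variable {𝔸 : Type*} [NormedRing 𝔸] [NormedAlgebra ℝ 𝔸] {G : LinearLieGroup 𝔸} {ι : Type*}

/-- The curvature `F = dA + A ∧ A`, in the trivialization over `U i`. -/
def F (A : ConicalConnection G ι) (i : ι) (p u v : E8) : 𝔸 :=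
  fderiv ℝ (A.A i) p u v - fderiv ℝ (A.A i) p v u + (A.A i p u * A.A i p v - A.A i p v * A.A i p u)

/-- The set of all real-valued 2-forms obtained as components of the curvature, with respect to
some linear functional on the fibre, at some point. Its span is contained in `Lie(Sp(2))` if and
only if the curvature takes values in `Lie(Sp(2)) ⊗ 𝔤_E`. -/
def curvatureComponents (A : ConicalConnection G ι) : Set (E8 → E8 → ℝ) :=
  {η | ∃ i, ∃ p ∈ A.U i, ∃ l : 𝔸 →L[ℝ] ℝ, η = fun u v => l (A.F i p u v)}

/-- `Ω⁰(𝔤_E)` on `S⁷`: smooth sections of the adjoint bundle, as families of local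
representatives. Each representative is extended by zero outside its chart. -/
def Omega0 (A : ConicalConnection G ι) : Submodule ℝ (ι → E8 → 𝔸) where
  carrier := {s | (∀ i, ContDiffOn ℝ ∞ (s i) (A.U i)) ∧ (∀ i, ∀ p ∉ A.U i, s i p = 0) ∧
    (∀ i, ∀ p ∈ A.U i, s i p ∈ G.lie) ∧
    (∀ i, ∀ p ∈ A.U i, ∀ t : ℝ, 0 < t → s i (t • p) = s i p) ∧
    (∀ i j, ∀ p ∈ A.U i ∩ A.U j, s i p = (A.g i j p : 𝔸) * s j p * ((A.g i j p)⁻¹ : 𝔸ˣ))}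
  zero_mem' := by
    refine ⟨fun i => ?_, by simp, fun i p _ => ?_, by simp, by simp⟩
    · exact contDiffOn_const
    · exact G.lie.zero_mem
  add_mem' := by
    rintro s t ⟨h1, h2, h3, h4, h5⟩ ⟨k1, k2, k3, k4, k5⟩
    refine ⟨fun i => (h1 i).add (k1 i), fun i p hp => ?_, fun i p hp => ?_, fun i p hp r hr => ?_,
      fun i j p hp => ?_⟩
    · simp [h2 i p hp, k2 i p hp]
    · exact G.lie.add_mem (h3 i p hp) (k3 i p hp)
    · simp [h4 i p hp r hr, k4 i p hp r hr]
    · simp only [Pi.add_apply]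
      rw [h5 i j p hp, k5 i j p hp, mul_add, add_mul]
  smul_mem' := by
    rintro c s ⟨h1, h2, h3, h4, h5⟩
    refine ⟨fun i => (h1 i).const_smul c, fun i p hp => ?_, fun i p hp => ?_,
      fun i p hp r hr => ?_, fun i j p hp => ?_⟩
    · simp [h2 i p hp]
    · exact G.lie.smul_mem c (h3 i p hp)
    · simp [h4 i p hp r hr]
    · simp only [Pi.smul_apply]
      rw [h5 i j p hp, mul_smul_comm, smul_mul_assoc]

/-- `Ω¹(𝔤_E)` on `S⁷`: smooth 1-forms with values in the adjoint bundle, as families of local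
representatives, identified with forms on the cone as explained above. Each representative is
extended by zero outside its chart. -/
def Omega1 (A : ConicalConnection G ι) : Submodule ℝ (ι → E8 → E8 →L[ℝ] 𝔸) where
  carrier := {α | (∀ i, ContDiffOn ℝ ∞ (α i) (A.U i)) ∧ (∀ i, ∀ p ∉ A.U i, α i p = 0) ∧
    (∀ i, ∀ p ∈ A.U i, ∀ v, α i p v ∈ G.lie) ∧
    (∀ i, ∀ p ∈ A.U i, α i p p = 0) ∧
    (∀ i, ∀ p ∈ A.U i, ∀ t : ℝ, 0 < t → t • α i (t • p) = α i p) ∧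
    (∀ i j, ∀ p ∈ A.U i ∩ A.U j, ∀ v,
      α i p v = (A.g i j p : 𝔸) * α j p v * ((A.g i j p)⁻¹ : 𝔸ˣ))}
  zero_mem' := by
    refine ⟨fun i => ?_, by simp, fun i p _ v => ?_, by simp, by simp, by simp⟩
    · exact contDiffOn_const
    · exact G.lie.zero_mem
  add_mem' := by
    rintro s t ⟨h1, h2, h3, h4, h5, h6⟩ ⟨k1, k2, k3, k4, k5, k6⟩
    refine ⟨fun i => (h1 i).add (k1 i), fun i p hp => ?_, fun i p hp v => ?_, fun i p hp => ?_,
      fun i p hp r hr => ?_, fun i j p hp v => ?_⟩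
    · simp [h2 i p hp, k2 i p hp]
    · exact G.lie.add_mem (h3 i p hp v) (k3 i p hp v)
    · simp [h4 i p hp, k4 i p hp]
    · simp only [Pi.add_apply, smul_add]
      rw [h5 i p hp r hr, k5 i p hp r hr]
    · simp only [Pi.add_apply, add_apply]
      rw [h6 i j p hp, k6 i j p hp, mul_add, add_mul]
  smul_mem' := by
    rintro c s ⟨h1, h2, h3, h4, h5, h6⟩
    refine ⟨fun i => (h1 i).const_smul c, fun i p hp => ?_, fun i p hp v => ?_,
      fun i p hp => ?_, fun i p hp r hr => ?_, fun i j p hp v => ?_⟩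
    · simp [h2 i p hp]
    · exact G.lie.smul_mem c (h3 i p hp v)
    · simp [h4 i p hp]
    · simp only [Pi.smul_apply]
      rw [smul_comm, h5 i p hp r hr]
    · simp only [Pi.smul_apply, smul_apply]
      rw [h6 i j p hp, mul_smul_comm, smul_mul_assoc]

/-- The covariant derivative `D_A u` of a section, in the trivialization over `U i`. -/
def cov0 (A : ConicalConnection G ι) (u : ι → E8 → 𝔸) (i : ι) (p v : E8) : 𝔸 :=
  fderiv ℝ (u i) p v + (A.A i p v * u i p - u i p * A.A i p v)

/-- The covariant derivative `(∇_u α)(v)` of a 1-form on the cone, for the flat metric of `ℝ⁸`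
coupled to `A`, in the trivialization over `U i`. At points of `S⁷` and for `u, v` tangent to `S⁷`,
this is the covariant derivative on `S⁷`, as `∇^{S⁷}` is the tangential part of `∇^{ℝ⁸}` and `α`
is annihilated by the radial vector field. -/
def cov1 (A : ConicalConnection G ι) (α : ι → E8 → E8 →L[ℝ] 𝔸) (i : ι) (p u v : E8) : 𝔸 :=
  fderiv ℝ (α i) p u v + (A.A i p u * α i p v - α i p v * A.A i p u)

/-- The exterior covariant derivative
`(D_A α)(u, v) = dα(u, v) + [A(u), α(v)] - [A(v), α(u)]`. -/
def extCov1 (A : ConicalConnection G ι) (α : ι → E8 → E8 →L[ℝ] 𝔸) (i : ι) (p u v : E8) : 𝔸 :=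
  A.cov1 α i p u v - A.cov1 α i p v u

/-- The codifferential `D_A^* α` on `S⁷` at a point `p` of the unit sphere: minus the trace of
`∇α` over the tangent space of `S⁷`, which is the trace over `ℝ⁸` less the radial term. -/
def codiff (A : ConicalConnection G ι) (α : ι → E8 → E8 →L[ℝ] 𝔸) (i : ι) (p : E8) : 𝔸 :=
  -((∑ a, A.cov1 α i p (e a) (e a)) - A.cov1 α i p p p)

/-- The 1-form `φ ⌟ D_A α = *(ψ ∧ D_A α)` on `S⁷` at a point `p` of the unit sphere, where
`(φ ⌟ b)(v) = ½ ∑ φ(v, eₐ, e_b) b(eₐ, e_b)` over an orthonormal basis of the tangent space. As `φ`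
is annihilated by the normal vector `p`, the sum may be taken over the basis of `ℝ⁸`. -/
def phiD (A : ConicalConnection G ι) (α : ι → E8 → E8 →L[ℝ] 𝔸) (i : ι) (p v : E8) : 𝔸 :=
  (1 / 2 : ℝ) • ∑ a, ∑ b, phiStd p v (e a) (e b) • A.extCov1 α i p (e a) (e b)

/-- The unit sphere `S⁷` intersected with the chart domain `U i`. -/
def sphereChart (A : ConicalConnection G ι) (i : ι) : Set E8 := A.U i ∩ Metric.sphere 0 1

theorem differentiableAt_of_mem (A : ConicalConnection G ι) {X : Type*} [NormedAddCommGroup X]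
    [NormedSpace ℝ X] {f : E8 → X} {i : ι} (hf : ContDiffOn ℝ ∞ f (A.U i)) {p : E8}
    (hp : p ∈ A.U i) : DifferentiableAt ℝ f p :=
  (hf.contDiffAt ((A.isOpen_U i).mem_nhds hp)).differentiableAt (by simp)

theorem cov0_add (A : ConicalConnection G ι) (u w : A.Omega0) {i : ι} {p : E8} (hp : p ∈ A.U i)
    (v : E8) : A.cov0 (u + w : A.Omega0) i p v = A.cov0 u i p v + A.cov0 w i p v := by
  have hu := A.differentiableAt_of_mem (u.2.1 i) hp
  have hw := A.differentiableAt_of_mem (w.2.1 i) hp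
  simp only [cov0, Submodule.coe_add, Pi.add_apply, fderiv_add hu hw,
    add_apply, mul_add, add_mul]
  abel

theorem cov0_smul (A : ConicalConnection G ι) (c : ℝ) (u : A.Omega0) {i : ι} {p : E8}
    (hp : p ∈ A.U i) (v : E8) : A.cov0 (c • u : A.Omega0) i p v = c • A.cov0 u i p v := by
  have hu := A.differentiableAt_of_mem (u.2.1 i) hp
  simp only [cov0, Submodule.coe_smul, Pi.smul_apply, fderiv_const_smul hu,
    smul_apply, mul_smul_comm, smul_mul_assoc, smul_add, smul_sub]

theorem cov1_add (A : ConicalConnection G ι) (α β : A.Omega1) {i : ι} {p : E8} (hp : p ∈ A.U i)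
    (u v : E8) : A.cov1 (α + β : A.Omega1) i p u v = A.cov1 α i p u v + A.cov1 β i p u v := by
  have hα := A.differentiableAt_of_mem (α.2.1 i) hp
  have hβ := A.differentiableAt_of_mem (β.2.1 i) hp
  simp only [cov1, Submodule.coe_add, Pi.add_apply, fderiv_add hα hβ,
    add_apply, mul_add, add_mul]
  abel

theorem cov1_smul (A : ConicalConnection G ι) (c : ℝ) (α : A.Omega1) {i : ι} {p : E8}
    (hp : p ∈ A.U i) (u v : E8) :
    A.cov1 (c • α : A.Omega1) i p u v = c • A.cov1 α i p u v := by
  have hα := A.differentiableAt_of_mem (α.2.1 i) hp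
  simp only [cov1, Submodule.coe_smul, Pi.smul_apply, fderiv_const_smul hα,
    smul_apply, mul_smul_comm, smul_mul_assoc, smul_add, smul_sub]

/-- The deformation operator
`𝓛_A (u, α) = (D_A^* α, D_A u + *(ψ ∧ D_A α))` on `Ω⁰(𝔤_E) ⊕ Ω¹(𝔤_E)` over `S⁷`. Its value is
recorded by its local representatives: a function on `S⁷ ∩ U i` with values in the fibre, and a
1-form on `S⁷ ∩ U i`. -/
def deformationOp (A : ConicalConnection G ι) :
    (A.Omega0 × A.Omega1) →ₗ[ℝ]
      ((i : ι) → A.sphereChart i → 𝔸) × ((i : ι) → A.sphereChart i → E8 → 𝔸) where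
  toFun s := (fun i p => A.codiff s.2 i p, fun i p v => A.cov0 s.1 i p v + A.phiD s.2 i p v)
  map_add' s t := by
    ext i p
    · have h := A.cov1_add s.2 t.2 p.2.1
      simp only [codiff, Prod.snd_add, Prod.fst_add, Pi.add_apply, h, Finset.sum_add_distrib]
      abel
    · rename_i v
      have h := A.cov1_add s.2 t.2 p.2.1
      simp only [phiD, extCov1, Prod.snd_add, Prod.fst_add, Pi.add_apply, h,
        A.cov0_add s.1 t.1 p.2.1]
      have h' : ∀ a b c d : 𝔸, a + b - (c + d) = (a - c) + (b - d) := fun a b c d => by abel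
      simp only [h', smul_add, Finset.sum_add_distrib]
      abel
  map_smul' c s := by
    ext i p
    · have h := A.cov1_smul c s.2 p.2.1
      simp only [codiff, Prod.smul_snd, Prod.smul_fst, Pi.smul_apply, h, ← Finset.smul_sum,
        ← smul_sub, smul_neg, RingHom.id_apply]
    · rename_i v
      have h := A.cov1_smul c s.2 p.2.1
      simp only [phiD, extCov1, Prod.smul_snd, Prod.smul_fst, Pi.smul_apply, h,
        A.cov0_smul c s.1 p.2.1, ← smul_sub, RingHom.id_apply, smul_add]
      congr 1
      simp only [Finset.smul_sum]
      refine Finset.sum_congr rfl fun a _ => Finset.sum_congr rfl fun b _ => ?_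
      simp only [smul_smul]
      congr 1
      ring

/-- The 1-forms `α` with `𝓛_A (0, α) = 0`, as a subspace of the space of families of local
representatives. -/
def kerDeformation (A : ConicalConnection G ι) : Submodule ℝ (ι → E8 → E8 →L[ℝ] 𝔸) :=
  (LinearMap.ker (A.deformationOp ∘ₗ LinearMap.inr ℝ A.Omega0 A.Omega1)).map A.Omega1.subtype

/-- The 1-forms `α ∈ Ω¹(𝔤_E)` in Coulomb gauge, `D_A^* α = 0` on `S⁷`. -/
def coulomb (A : ConicalConnection G ι) : Submodule ℝ (ι → E8 → E8 →L[ℝ] 𝔸) :=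
  (LinearMap.ker (LinearMap.fst ℝ _ _ ∘ₗ A.deformationOp ∘ₗ
    LinearMap.inr ℝ A.Omega0 A.Omega1)).map A.Omega1.subtype

open Classical in
/-- The `𝔤_E`-valued 1-form `α_M = X_M ⌟ F_A`, where `X_M(p) = M p`, as a linear function of the
endomorphism `M` of `ℝ⁸`. -/
def alpha (A : ConicalConnection G ι) : (E8 →L[ℝ] E8) →ₗ[ℝ] (ι → E8 → E8 →L[ℝ] 𝔸) where
  toFun M i p := if p ∈ A.U i then LinearMap.toContinuousLinearMap
    { toFun := fun v => A.F i p (M p) v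
      map_add' := fun v w => by simp [F, mul_add, add_mul]; abel
      map_smul' := fun t v => by simp [F, smul_add, smul_sub] } else 0
  map_add' M N := by
    ext i p v
    by_cases hp : p ∈ A.U i
    · simp [hp, F, mul_add, add_mul]; abel
    · simp [hp]
  map_smul' t M := by
    ext i p v
    by_cases hp : p ∈ A.U i
    · simp [hp, F, smul_add, smul_sub]
    · simp [hp]

/-- The space `{α_M | M ∈ W ⊕ W I₁ ⊕ W I₂}`. -/
def linearDeformations (A : ConicalConnection G ι) : Submodule ℝ (ι → E8 → E8 →L[ℝ] 𝔸) :=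
  W₁₂.map A.alpha

end ConicalConnection

/-! ### The standard `G₂`-instanton -/

/-- The group `Sp(1)` of unit quaternions, with Lie algebra `Im ℍ`. -/
def Sp1 : LinearLieGroup ℍ where
  group :=
    { carrier := {u | ‖(u : ℍ)‖ = 1}
      mul_mem' := fun {a b} ha hb => by
        simp only [Set.mem_ofPred_eq] at *; simp [ha, hb]
      one_mem' := by simp
      inv_mem' := fun {a} ha => by
        simp only [Set.mem_ofPred_eq] at *; simp [ha] }
  isClosed := isClosed_eq (continuous_norm.comp Units.continuous_val) continuous_const
  lie :=
    { carrier := {q | q.re = 0}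
      add_mem' := fun {a b} ha hb => by simp only [Set.mem_ofPred_eq] at *; simp [ha, hb]
      zero_mem' := by simp
      smul_mem' := fun c a ha => by simp only [Set.mem_ofPred_eq] at *; simp [ha] }
  commutator_mem := fun X hX Y hY => by
    change (X * Y - Y * X).re = 0
    simp
    ring
  mem_lie := fun X => by
    constructor
    · intro hX t
      have hX' : X.re = 0 := hX
      have hn : ‖NormedSpace.exp (t • X)‖ = 1 := by
        rw [Quaternion.norm_exp]; simp [hX']
      have h0 : NormedSpace.exp (t • X) ≠ 0 := fun h => by simp [h] at hn
      exact ⟨Units.mk0 _ h0, hn, rfl⟩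
    · intro h
      obtain ⟨u, hu, hu'⟩ := h 1
      have hn : ‖(u : ℍ)‖ = 1 := hu
      rw [hu', Quaternion.norm_exp, one_smul, ← Real.exp_eq_exp_ℝ, Real.norm_eq_abs,
        Real.abs_exp, Real.exp_eq_one_iff] at hn
      exact hn

/-- The connection form `Im (w dw̄ + z dz̄) / (|w|² + |z|²)` of the standard anti-self-dual
instanton, on the total space `ℍ² ∖ {0}` of the left Hopf fibration. -/
def stdAsdForm (q : ℍ × ℍ) : ℍ × ℍ →L[ℝ] ℍ := LinearMap.toContinuousLinearMap
  { toFun := fun dq => (Quaternion.normSq q.1 + Quaternion.normSq q.2)⁻¹ •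
      Quaternion.im (q.1 * star dq.1 + q.2 * star dq.2)
    map_add' := fun a b => by
      rw [← smul_add, ← Quaternion.im_add]
      congr 2
      simp only [Prod.fst_add, Prod.snd_add, star_add, mul_add]
      abel
    map_smul' := fun t a => by
      rw [RingHom.id_apply, smul_comm, ← Quaternion.im_smul]
      simp [smul_add] }

/-- The open cones `{x ≠ 0, y ≠ 0}`, `{x ≠ 0}` and `{y ≠ 0}` in `ℝ⁸ = ℍ²`. -/
def stdChart : Fin 3 → Set E8
  | 0 => {p | qx p ≠ 0 ∧ qy p ≠ 0}
  | 1 => {p | qx p ≠ 0}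
  | 2 => {p | qy p ≠ 0}

/-- The fibre-preserving map `(x, y) ↦ (w, z) = (y⁻¹, x⁻¹)` from the right to the left Hopf
fibration, which covers the identity of `S⁴` in the sense that `w⁻¹ z = y x⁻¹`, followed by its
left multiples by `y` and by `x`, which extend smoothly to `{x ≠ 0}` and to `{y ≠ 0}`. After
normalization, these are local sections of the pullback to `S⁷`, under the right Hopf fibration,
of the left Hopf fibration. -/
def stdLift : Fin 3 → E8 → ℍ × ℍ
  | 0, p => ((qy p)⁻¹, (qx p)⁻¹)
  | 1, p => (1, qy p * (qx p)⁻¹)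
  | 2, p => (qx p * (qy p)⁻¹, 1)

/-- The factors `1`, `y`, `x` by which the three local lifts differ. -/
def stdFactor : Fin 3 → E8 → ℍ
  | 0, _ => 1
  | 1, p => qy p
  | 2, p => qx p

/-- The quotient of two of the factors, so that `stdLift i = stdRatio i j * stdLift j`. -/
def stdRatio (i j : Fin 3) (p : E8) : ℍ :=
  if i = j then 1 else stdFactor i p * (stdFactor j p)⁻¹

open Classical in
/-- The unit quaternion `q / |q|`; by convention, it is `1` for `q = 0`. -/
def unitize (q : ℍ) : ℍˣ :=
  if h : q = 0 then 1
  else Units.mk0 (‖q‖⁻¹ • q) (smul_ne_zero (inv_ne_zero (norm_ne_zero_iff.mpr h)) h)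

theorem unitize_val {q : ℍ} (h : q ≠ 0) : (unitize q : ℍ) = ‖q‖⁻¹ • q := by
  simp [unitize, h]

theorem unitize_norm (q : ℍ) : ‖(unitize q : ℍ)‖ = 1 := by
  by_cases h : q = 0
  · simp [unitize, h]
  · rw [unitize_val h, norm_smul, norm_inv, norm_norm, inv_mul_cancel₀ (norm_ne_zero_iff.mpr h)]

theorem unitize_mul {q r : ℍ} (hq : q ≠ 0) (hr : r ≠ 0) :
    unitize q * unitize r = unitize (q * r) := by
  ext1
  rw [Units.val_mul, unitize_val hq, unitize_val hr, unitize_val (mul_ne_zero hq hr), norm_mul,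
    mul_inv, smul_mul_smul_comm]

theorem unitize_smul {q : ℍ} (hq : q ≠ 0) {t : ℝ} (ht : 0 < t) : unitize (t • q) = unitize q := by
  ext1
  rw [unitize_val hq, unitize_val (smul_ne_zero ht.ne' hq), norm_smul, Real.norm_of_nonneg ht.le,
    smul_smul, mul_inv, mul_comm t⁻¹, mul_assoc, inv_mul_cancel₀ ht.ne', mul_one]

theorem isOpen_stdChart (i : Fin 3) : IsOpen (stdChart i) := by
  have hx : IsOpen {p : E8 | qx p ≠ 0} := isOpen_ne_fun qx.continuous continuous_const
  have hy : IsOpen {p : E8 | qy p ≠ 0} := isOpen_ne_fun qy.continuous continuous_const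
  fin_cases i
  · exact hx.inter hy
  · exact hx
  · exact hy

theorem ne_zero_of_mem {i j : Fin 3} (h : i ≠ j) {p : E8} (hp : p ∈ stdChart i ∩ stdChart j) :
    qx p ≠ 0 ∧ qy p ≠ 0 := by
  obtain ⟨h1, h2⟩ := hp
  fin_cases i <;> fin_cases j <;> simp_all [stdChart]

theorem stdFactor_ne_zero (i : Fin 3) {p : E8} (hp : qx p ≠ 0 ∧ qy p ≠ 0) :
    stdFactor i p ≠ 0 := by
  fin_cases i <;> simp_all [stdFactor]

theorem stdRatio_ne_zero (i j : Fin 3) {p : E8} (hp : p ∈ stdChart i ∩ stdChart j) :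
    stdRatio i j p ≠ 0 := by
  unfold stdRatio
  split_ifs with h
  · exact one_ne_zero
  · have := ne_zero_of_mem h hp
    exact mul_ne_zero (stdFactor_ne_zero i this) (inv_ne_zero (stdFactor_ne_zero j this))

theorem stdRatio_eq (i j : Fin 3) {p : E8} (hp : qx p ≠ 0 ∧ qy p ≠ 0) :
    stdRatio i j p = stdFactor i p * (stdFactor j p)⁻¹ := by
  unfold stdRatio
  split_ifs with h
  · rw [h, mul_inv_cancel₀ (stdFactor_ne_zero j hp)]
  · rfl

theorem stdLift_eq_factor (i : Fin 3) {p : E8} (hp : qx p ≠ 0 ∧ qy p ≠ 0) :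
    stdLift i p = (stdFactor i p * (qy p)⁻¹, stdFactor i p * (qx p)⁻¹) := by
  fin_cases i <;> simp_all [stdFactor, stdLift]

theorem stdLift_eq (i j : Fin 3) {p : E8} (hp : p ∈ stdChart i ∩ stdChart j) :
    stdLift i p = (stdRatio i j p * (stdLift j p).1, stdRatio i j p * (stdLift j p).2) := by
  by_cases h : i = j
  · simp [stdRatio, h]
  · have h0 := ne_zero_of_mem h hp
    rw [stdRatio_eq i j h0, stdLift_eq_factor i h0, stdLift_eq_factor j h0]
    have := stdFactor_ne_zero j h0
    ext1 <;> simp only [mul_assoc] <;> rw [inv_mul_cancel_left₀ this]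

theorem stdLift_ne_zero (i : Fin 3) {p : E8} (hp : p ∈ stdChart i) : stdLift i p ≠ 0 := by
  fin_cases i <;> simp_all [stdChart, stdLift]

theorem contDiffOn_stdFactor (i : Fin 3) : ContDiff ℝ ∞ (stdFactor i) := by
  fin_cases i
  · exact contDiff_const
  · exact qy.contDiff
  · exact qx.contDiff

theorem contDiffOn_inv {f : E8 → ℍ} {s : Set E8} (hf : ContDiffOn ℝ ∞ f s)
    (h : ∀ p ∈ s, f p ≠ 0) : ContDiffOn ℝ ∞ (fun p => (f p)⁻¹) s := by
  intro p hp
  have hu : ContDiffAt ℝ ∞ Ring.inverse (f p) := contDiffAt_ringInverse ℝ (Units.mk0 _ (h p hp))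
  have := hu.comp_contDiffWithinAt p (hf p hp)
  simpa only [Ring.inverse_eq_inv', Function.comp_def] using this

theorem contDiffOn_stdLift (i : Fin 3) : ContDiffOn ℝ ∞ (stdLift i) (stdChart i) := by
  have hx : ∀ s, ContDiffOn ℝ ∞ (fun p : E8 => qx p) s := fun s => qx.contDiff.contDiffOn
  have hy : ∀ s, ContDiffOn ℝ ∞ (fun p : E8 => qy p) s := fun s => qy.contDiff.contDiffOn
  fin_cases i
  · exact (contDiffOn_inv (hy _) fun p hp => hp.2).prodMk (contDiffOn_inv (hx _) fun p hp => hp.1)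
  · exact contDiffOn_const.prodMk ((hy _).mul (contDiffOn_inv (hx _) fun p hp => hp))
  · exact ((hx _).mul (contDiffOn_inv (hy _) fun p hp => hp)).prodMk contDiffOn_const

theorem contDiffOn_stdRatio (i j : Fin 3) :
    ContDiffOn ℝ ∞ (stdRatio i j) (stdChart i ∩ stdChart j) := by
  by_cases h : i = j
  · have : stdRatio i j = fun _ => 1 := by ext1 p; simp [stdRatio, h]
    rw [this]
    exact contDiffOn_const
  · have : stdRatio i j = fun p => stdFactor i p * (stdFactor j p)⁻¹ := by
      ext1 p; simp [stdRatio, h]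
    rw [this]
    exact (contDiffOn_stdFactor i).contDiffOn.mul (contDiffOn_inv
      (contDiffOn_stdFactor j).contDiffOn fun p hp => stdFactor_ne_zero j (ne_zero_of_mem h hp))

/-- The connection matrix of the standard instanton: the pullback of the connection form of the
standard anti-self-dual instanton by the local lift. -/
def stdA (i : Fin 3) (p : E8) : E8 →L[ℝ] ℍ :=
  (stdAsdForm (stdLift i p)).comp (fderiv ℝ (stdLift i) p)

theorem stdAsdForm_apply (q dq : ℍ × ℍ) : stdAsdForm q dq =
    (Quaternion.normSq q.1 + Quaternion.normSq q.2)⁻¹ •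
      Quaternion.im (q.1 * star dq.1 + q.2 * star dq.2) := rfl

theorem normSq_add_ne_zero {q : ℍ × ℍ} (h : q ≠ 0) :
    Quaternion.normSq q.1 + Quaternion.normSq q.2 ≠ 0 := by
  intro h0
  have h1 := Quaternion.normSq_nonneg (a := q.1)
  have h2 := Quaternion.normSq_nonneg (a := q.2)
  refine h (Prod.ext (Quaternion.normSq_eq_zero.mp ?_) (Quaternion.normSq_eq_zero.mp ?_)) <;>
    linarith

theorem contDiffOn_stdAsdForm : ContDiffOn ℝ ∞ stdAsdForm {q | q ≠ 0} := by
  rw [contDiffOn_clm_apply]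
  intro dq
  have hre : ContDiff ℝ ∞ fun q : ℍ => Quaternion.normSq q := by
    have : (fun q : ℍ => Quaternion.normSq q) = fun q => inner ℝ q q := by
      ext q; rw [Quaternion.inner_self]
    rw [this]
    exact contDiff_id.inner ℝ contDiff_id
  let im : ℍ →L[ℝ] ℍ := LinearMap.toContinuousLinearMap
    { toFun := Quaternion.im
      map_add' := fun a b => Quaternion.im_add a b
      map_smul' := fun t a => Quaternion.im_smul a t }
  have him : ContDiff ℝ ∞ fun q : ℍ => Quaternion.im q := im.contDiff
  have h1 : ContDiff ℝ ∞ fun q : ℍ × ℍ => Quaternion.normSq q.1 + Quaternion.normSq q.2 :=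
    (hre.comp contDiff_fst).add (hre.comp contDiff_snd)
  refine ContDiffOn.smul (h1.contDiffOn.inv fun q hq => normSq_add_ne_zero hq)
    (ContDiff.contDiffOn ?_)
  exact him.comp ((contDiff_fst.mul contDiff_const).add (contDiff_snd.mul contDiff_const))

theorem contDiffOn_stdA (i : Fin 3) : ContDiffOn ℝ ∞ (stdA i) (stdChart i) := by
  have h1 := contDiffOn_stdLift i
  have h2 : ContDiffOn ℝ ∞ (fderiv ℝ (stdLift i)) (stdChart i) :=
    h1.fderiv_of_isOpen (isOpen_stdChart i) (by simp)
  exact (contDiffOn_stdAsdForm.comp h1 fun p hp => stdLift_ne_zero i hp).clm_comp h2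

theorem stdA_mem (i : Fin 3) (p v : E8) : stdA i p v ∈ Sp1.lie := by
  change (stdA i p v).re = 0
  simp [stdA, stdAsdForm_apply]

theorem differentiableAt_stdLift (i : Fin 3) {p : E8} (hp : p ∈ stdChart i) :
    DifferentiableAt ℝ (stdLift i) p :=
  ((contDiffOn_stdLift i).contDiffAt ((isOpen_stdChart i).mem_nhds hp)).differentiableAt (by simp)

/-- The degree of homogeneity of the local lifts. -/
theorem stdLift_smul (i : Fin 3) (t : ℝ) (ht : 0 < t) (p : E8) :
    stdLift i (t • p) = (if i = 0 then t⁻¹ else 1) • stdLift i p := by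
  have h : ∀ q : ℍ, (t • q)⁻¹ = t⁻¹ • q⁻¹ := fun q => by
    rw [← Quaternion.coe_mul_eq_smul, mul_inv_rev, ← Quaternion.coe_inv,
      ← Quaternion.coe_mul_eq_smul, Quaternion.coe_commutes]
  fin_cases i <;> simp [stdLift, h, smul_smul, ht.ne']

theorem stdAsdForm_smul (c : ℝ) (hc : c ≠ 0) (q dq : ℍ × ℍ) :
    stdAsdForm (c • q) (c • dq) = stdAsdForm q dq := by
  have h : (c • q).1 * star (c • dq).1 + (c • q).2 * star (c • dq).2 =
      (c * c) • (q.1 * star dq.1 + q.2 * star dq.2) := by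
    simp [smul_smul, smul_add]
  have h' : Quaternion.normSq (c • q).1 + Quaternion.normSq (c • q).2 =
      (c * c) * (Quaternion.normSq q.1 + Quaternion.normSq q.2) := by
    simp [Quaternion.normSq_smul]; ring
  rw [stdAsdForm_apply, stdAsdForm_apply, h, h', Quaternion.im_smul, smul_smul, mul_inv,
    mul_right_comm, inv_mul_cancel₀ (mul_ne_zero hc hc), one_mul]

theorem stdA_conical (i : Fin 3) (p : E8) (t : ℝ) (ht : 0 < t) :
    t • stdA i (t • p) = stdA i p := by
  obtain ⟨c, hc, h⟩ : ∃ c : ℝ, c ≠ 0 ∧ ∀ q, stdLift i (t • q) = c • stdLift i q :=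
    ⟨if i = 0 then t⁻¹ else 1, by split_ifs <;> simp [ht.ne'], stdLift_smul i t ht⟩
  have hd : t • fderiv ℝ (stdLift i) (t • p) = c • fderiv ℝ (stdLift i) p := by
    have := fderiv_comp_smul (𝕜 := ℝ) (f := stdLift i) (x := p) t
    rw [← this, show (fun x => stdLift i (t • x)) = c • stdLift i from funext h]
    have := invertibleOfNonzero hc
    exact fderiv_const_smul_of_invertible c
  ext1 v
  have hv : t • fderiv ℝ (stdLift i) (t • p) v = c • fderiv ℝ (stdLift i) p v :=
    congrArg (fun l : E8 →L[ℝ] ℍ × ℍ => l v) hd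
  rw [smul_apply, stdA, ContinuousLinearMap.comp_apply, ← map_smul, hv, h, stdAsdForm_smul c hc]
  rfl

theorem stdA_radial (i : Fin 3) {p : E8} (hp : p ∈ stdChart i) : stdA i p p = 0 := by
  obtain ⟨c, h⟩ : ∃ c : ℝ, fderiv ℝ (stdLift i) p p = c • stdLift i p := by
    have h1 : HasDerivAt (fun t : ℝ => stdLift i (t • p)) (fderiv ℝ (stdLift i) p p) 1 := by
      have hl : HasDerivAt (fun t : ℝ => t • p) p 1 := by
        simpa using (hasDerivAt_id (1 : ℝ)).smul_const p
      have hf : HasFDerivAt (stdLift i) (fderiv ℝ (stdLift i) p) ((1 : ℝ) • p) := by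
        rw [one_smul]; exact (differentiableAt_stdLift i hp).hasFDerivAt
      exact hf.comp_hasDerivAt 1 hl
    obtain ⟨c, hc⟩ : ∃ c : ℝ, HasDerivAt (fun t : ℝ => if i = 0 then t⁻¹ else 1) c 1 := by
      split_ifs
      · exact ⟨_, hasDerivAt_inv one_ne_zero⟩
      · exact ⟨0, hasDerivAt_const 1 1⟩
    refine ⟨c, h1.unique ((hc.smul_const (stdLift i p)).congr_of_eventuallyEq ?_)⟩
    filter_upwards [lt_mem_nhds (zero_lt_one (α := ℝ))] with t ht
    exact stdLift_smul i t ht p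
  rw [stdA, ContinuousLinearMap.comp_apply, h, map_smul, stdAsdForm_apply]
  have : Quaternion.im ((stdLift i p).1 * star (stdLift i p).1 +
      (stdLift i p).2 * star (stdLift i p).2) = 0 := by
    rw [Quaternion.self_mul_star, Quaternion.self_mul_star, ← Quaternion.coe_add, Quaternion.im_coe]
  rw [this, smul_zero, smul_zero]

theorem im_conj (s x : ℍ) : Quaternion.im (s * x * star s) = s * Quaternion.im x * star s := by
  ext <;> simp <;> ring

theorem unitize_inv {q : ℍ} (h : q ≠ 0) : ((unitize q)⁻¹ : ℍˣ) = ‖q‖⁻¹ • star q := by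
  rw [Units.inv_eq_of_mul_eq_one_right]
  rw [unitize_val h, smul_mul_smul_comm, Quaternion.self_mul_star,
    Quaternion.normSq_eq_norm_mul_self, ← Quaternion.coe_mul_eq_smul, ← Quaternion.coe_mul]
  have : ‖q‖ ≠ 0 := norm_ne_zero_iff.mpr h
  rw [show ‖q‖⁻¹ * ‖q‖⁻¹ * (‖q‖ * ‖q‖) = 1 by field_simp, Quaternion.coe_one]

/-- The logarithmic derivative of `s / |s|`. -/
theorem fderiv_unitize {s : E8 → ℍ} {p : E8} (hs : DifferentiableAt ℝ s p) (h0 : s p ≠ 0)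
    (v : E8) : fderiv ℝ (fun q => (unitize (s q) : ℍ)) p v * ((unitize (s p))⁻¹ : ℍˣ) =
      (Quaternion.normSq (s p))⁻¹ • Quaternion.im (fderiv ℝ s p v * star (s p)) := by
  have hn : ‖s p‖ ≠ 0 := norm_ne_zero_iff.mpr h0
  have hev : (fun q => (unitize (s q) : ℍ)) =ᶠ[nhds p] fun q => ‖s q‖⁻¹ • s q := by
    filter_upwards [hs.continuousAt.eventually_ne h0] with q hq
    exact unitize_val hq
  have hd : DifferentiableAt ℝ (fun q => ‖s q‖⁻¹) p := (hs.norm ℝ h0).inv hn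
  have hN : fderiv ℝ (fun q => ‖s q‖⁻¹) p v * (‖s p‖ * ‖s p‖) =
      -(‖s p‖⁻¹ * (fderiv ℝ s p v * star (s p)).re) := by
    have h1 : HasFDerivAt (fun q => ‖s q‖ ^ 2) _ p := hs.hasFDerivAt.norm_sq
    have h2 : HasFDerivAt (fun q => (‖s q‖⁻¹) ^ 2) _ p := hd.hasFDerivAt.pow 2
    have h3 := h2.mul h1
    have h4 : (fun q => (‖s q‖⁻¹) ^ 2 * ‖s q‖ ^ 2) =ᶠ[nhds p] fun _ => (1 : ℝ) := by
      filter_upwards [hs.continuousAt.eventually_ne h0] with q hq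
      have : ‖s q‖ ≠ 0 := norm_ne_zero_iff.mpr hq
      field_simp
    have h5 := (h3.congr_of_eventuallyEq h4.symm).unique (hasFDerivAt_const (1 : ℝ) p)
    have h6 := congrArg (fun l => l v) h5
    simp [Quaternion.inner_def] at h6
    simp only [Quaternion.re_mul, Quaternion.re_star, Quaternion.imI_star, Quaternion.imJ_star,
      Quaternion.imK_star]
    generalize fderiv ℝ (fun q => ‖s q‖⁻¹) p v = X at h6 ⊢
    generalize ‖s p‖ = r at h6 hn ⊢
    field_simp at h6 ⊢
    linear_combination h6 / 2
  rw [hev.fderiv_eq, fderiv_fun_smul hd hs, unitize_inv h0]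
  simp only [add_apply, smul_apply, ContinuousLinearMap.smulRight_apply,
    mul_smul_comm, add_mul, smul_mul_assoc, Quaternion.self_mul_star]
  rw [Quaternion.normSq_eq_norm_mul_self]
  generalize fderiv ℝ (fun q => ‖s q‖⁻¹) p v = X at hN ⊢
  generalize fderiv ℝ s p v * star (s p) = Y at hN ⊢
  generalize ‖s p‖ = r at hN hn ⊢
  have hX : X * (r * r) = -(r⁻¹ * Y.re) := hN
  have hY := Quaternion.re_add_im Y
  have h1 : X • ((r * r : ℝ) : ℍ) = ((-(r⁻¹ * Y.re) : ℝ) : ℍ) := by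
    rw [← Quaternion.coe_mul_eq_smul, ← Quaternion.coe_mul, hX]
  rw [h1]
  generalize hk : -(r⁻¹ * Y.re) = k
  have hk' : r⁻¹ * Y.re + k = 0 := by rw [← hk, add_neg_cancel]
  ext
  · simp only [Quaternion.re_smul, Quaternion.re_add, Quaternion.re_coe, Quaternion.re_im,
      smul_eq_mul, mul_zero]
    rw [hk', mul_zero]
  all_goals
    simp
    ring

theorem mul_star_add (s w ds dw : ℍ) : s * w * star (ds * w + s * dw) =
    Quaternion.normSq w • (s * star ds) + s * (w * star dw) * star s := by
  rw [star_add, star_mul, star_mul, mul_add]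
  congr 1
  · rw [mul_assoc, ← mul_assoc w, Quaternion.self_mul_star, Quaternion.coe_mul_eq_smul,
      mul_smul_comm]
  · simp only [mul_assoc]

/-- If a local lift is multiplied from the left by `s`, then the pullback of the connection form
is changed by the gauge transformation `s / |s|`. -/
theorem stdAsdForm_gauge {σ : E8 → ℍ × ℍ} {s : E8 → ℍ} {p : E8} (hσ : DifferentiableAt ℝ σ p)
    (hs : DifferentiableAt ℝ s p) (h0 : s p ≠ 0) (hσ0 : σ p ≠ 0) (v : E8) :
    stdAsdForm (s p * (σ p).1, s p * (σ p).2)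
        (fderiv ℝ (fun q => (s q * (σ q).1, s q * (σ q).2)) p v) =
      (unitize (s p) : ℍ) * stdAsdForm (σ p) (fderiv ℝ σ p v) * ((unitize (s p))⁻¹ : ℍˣ)
        - fderiv ℝ (fun q => (unitize (s q) : ℍ)) p v * ((unitize (s p))⁻¹ : ℍˣ) := by
  have hd : fderiv ℝ (fun q => (s q * (σ q).1, s q * (σ q).2)) p v =
      (fderiv ℝ s p v * (σ p).1 + s p * (fderiv ℝ σ p v).1,
        fderiv ℝ s p v * (σ p).2 + s p * (fderiv ℝ σ p v).2) := by
    have h1 : HasFDerivAt (fun q => (σ q).1) _ p := hσ.hasFDerivAt.fst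
    have h2 : HasFDerivAt (fun q => (σ q).2) _ p := hσ.hasFDerivAt.snd
    have h3 := (hs.hasFDerivAt.mul' h1).prodMk (hs.hasFDerivAt.mul' h2)
    have h4 := h3.fderiv
    refine (congrArg (fun l => l v) h4).trans ?_
    ext1
    · exact add_comm _ _
    · exact add_comm _ _
  rw [fderiv_unitize hs h0, hd, stdAsdForm_apply, stdAsdForm_apply, unitize_inv h0,
    unitize_val h0]
  have hn : Quaternion.normSq (s p) ≠ 0 := Quaternion.normSq_ne_zero.mpr h0
  have hr : ‖s p‖⁻¹ * ‖s p‖⁻¹ = (Quaternion.normSq (s p))⁻¹ := by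
    rw [Quaternion.normSq_eq_norm_mul_self, mul_inv]
  have hm := normSq_add_ne_zero hσ0
  simp only [mul_star_add, map_mul]
  generalize fderiv ℝ s p v = ds
  generalize fderiv ℝ σ p v = dσ
  generalize s p = S at *
  generalize σ p = q at *
  rw [show ∀ a b c d : ℍ, a + S * b * star S + (c + S * d * star S) =
      (a + c) + S * (b + d) * star S by intros; noncomm_ring,
    Quaternion.im_add, im_conj, ← add_smul, Quaternion.im_smul]
  generalize Quaternion.im (q.1 * star dσ.1 + q.2 * star dσ.2) = Z
  have hi : Quaternion.im (S * star ds) = -Quaternion.im (ds * star S) := by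
    ext <;> simp <;> ring
  rw [hi, smul_mul_smul_comm, smul_mul_smul_comm, mul_right_comm, hr, ← mul_add, mul_inv,
    smul_add, smul_smul, mul_assoc, inv_mul_cancel₀ hm, mul_one, smul_neg]
  abel

/-- The standard `G₂`-instanton `A₀`: the pullback by the right Hopf fibration of the standard
anti-self-dual instanton, as an `Sp(1)`-connection, given in three local trivializations. Over
`{x ≠ 0, y ≠ 0}`, the connection matrix is `Im (|y|² x⁻¹ dx + |x|² y⁻¹ dy) / (|x|² + |y|²)`. -/
def stdInstanton : ConicalConnection Sp1 (Fin 3) where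
  U := stdChart
  isOpen_U := isOpen_stdChart
  zero_notMem_U i := by fin_cases i <;> simp [stdChart]
  cover p hp := by
    by_cases hx : qx p = 0
    · refine ⟨2, fun hy => hp ?_⟩
      rw [← ofQuat_qx_qy p, hx, hy]
      exact map_zero ofQuat
    · exact ⟨1, hx⟩
  cone i p hp t ht := by
    fin_cases i <;> simp_all [stdChart, ht.ne']
  g i j p := unitize (stdRatio i j p)
  g_mem i j p _ := unitize_norm _
  g_smooth i j := by
    have h := contDiffOn_stdRatio i j
    have h' : ContDiffOn ℝ ∞ (fun p => ‖stdRatio i j p‖⁻¹ • stdRatio i j p)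
        (stdChart i ∩ stdChart j) :=
      ((h.norm ℝ fun p hp => stdRatio_ne_zero i j hp).inv
        fun p hp => norm_ne_zero_iff.mpr (stdRatio_ne_zero i j hp)).smul h
    exact h'.congr fun p hp => unitize_val (stdRatio_ne_zero i j hp)
  g_cocycle i j k p hp := by
    obtain ⟨⟨hi, hj⟩, hk⟩ := hp
    rw [unitize_mul (stdRatio_ne_zero i j ⟨hi, hj⟩) (stdRatio_ne_zero j k ⟨hj, hk⟩)]
    congr 1
    by_cases hij : i = j
    · subst hij; simp [stdRatio]
    · have h := ne_zero_of_mem hij ⟨hi, hj⟩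
      rw [stdRatio_eq i j h, stdRatio_eq j k h, stdRatio_eq i k h, mul_assoc,
        inv_mul_cancel_left₀ (stdFactor_ne_zero j h)]
  g_conical i j p hp t ht := by
    obtain ⟨c, hc, h⟩ : ∃ c : ℝ, 0 < c ∧ stdRatio i j (t • p) = c • stdRatio i j p := by
      have hi : ∀ q : ℍ, (t • q)⁻¹ = t⁻¹ • q⁻¹ := fun q => by
        rw [← Quaternion.coe_mul_eq_smul, mul_inv_rev, ← Quaternion.coe_inv,
          ← Quaternion.coe_mul_eq_smul, Quaternion.coe_commutes]
      have hf : ∀ k, ∃ c : ℝ, 0 < c ∧ stdFactor k (t • p) = c • stdFactor k p ∧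
          (stdFactor k (t • p))⁻¹ = c⁻¹ • (stdFactor k p)⁻¹ := by
        intro k
        fin_cases k
        · exact ⟨1, one_pos, by simp [stdFactor], by simp [stdFactor]⟩
        · exact ⟨t, ht, by simp [stdFactor], by simp [stdFactor, hi]⟩
        · exact ⟨t, ht, by simp [stdFactor], by simp [stdFactor, hi]⟩
      by_cases hij : i = j
      · exact ⟨1, one_pos, by simp [stdRatio, hij]⟩
      · obtain ⟨a, ha, ha', -⟩ := hf i
        obtain ⟨b, hb, -, hb'⟩ := hf j
        refine ⟨a * b⁻¹, by positivity, ?_⟩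
        simp only [stdRatio, hij, if_false]
        rw [ha', hb', smul_mul_smul_comm]
    rw [h, unitize_smul (stdRatio_ne_zero i j hp) hc]
  A := stdA
  A_smooth := contDiffOn_stdA
  A_mem i p _ v := stdA_mem i p v
  A_radial i p hp := stdA_radial i hp
  A_conical i p _ t ht := stdA_conical i p t ht
  A_gauge i j p hp v := by
    have hopen : IsOpen (stdChart i ∩ stdChart j) := (isOpen_stdChart i).inter (isOpen_stdChart j)
    have hs : DifferentiableAt ℝ (stdRatio i j) p :=
      ((contDiffOn_stdRatio i j).contDiffAt (hopen.mem_nhds hp)).differentiableAt (by simp)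
    have hev : stdLift i =ᶠ[nhds p]
        fun q => (stdRatio i j q * (stdLift j q).1, stdRatio i j q * (stdLift j q).2) := by
      filter_upwards [hopen.mem_nhds hp] with q hq
      exact stdLift_eq i j hq
    have h := stdAsdForm_gauge (differentiableAt_stdLift j hp.2) hs (stdRatio_ne_zero i j hp)
      (stdLift_ne_zero j hp.2) v
    rw [← hev.fderiv_eq, ← stdLift_eq i j hp] at h
    exact h

end G2Inst

end

namespace G2Inst

/-! Write `F` for the curvature. Two properties of it drive the whole argument: it is annihilated by
the radial vector (the connection is conical), and it satisfies `F(J u, J v) = F(u, v)` for `J = I₁,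
I₂, I₃` (it takes values in the skew-adjoint quaternionic endomorphisms).

Kernel. With `ω_k = ⟪I_k ·, ·⟫` one has `Ψ₀ = ½(ω₁² + ω₂² - ω₃²)` (`Psi0_eq`). If a 2-form is
orthogonal to every `ω_k` and is multiplied by `s_k` under `I_k`, then contraction with `Ψ₀`
multiplies it by `-2(s₁ + s₂ - s₃)`; the case `s₁ + s₂ - s₃ = 1` is `sum_Psi0`. By Bianchi, `D_A
α_M` at `p` is `∇_{Mp} F` plus `F(M·, ·) + F(·, M·)`. The first piece has signs `(1, 1, 1)`. The
second has signs `(1, 1, 1)`, `(1, -1, -1)`, `(-1, 1, -1)` for `M` in `W`, `W I₁`, `W I₂`. All of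
these give `s₁ + s₂ - s₃ = 1`, whereas `W I₃` would give `-3`. Hence `*(ψ ∧ D_A α_M)` is `-(D_A
α_M)(p, ·)`, and there the two pieces contribute `-F(Mp, ·)` and `F(Mp, ·)`, which cancel
(`phiD_alpha`).

Coulomb gauge. `D_A^* α_M` consists of the divergence of `F`, which vanishes by the Yang–Mills
equation `sum_covCurv`, and of the trace `∑ F(M eₐ, eₐ)`, which vanishes by symmetry of `M` or by
anticommutation with some `I_k` (`codiff_alpha`).

Dimension. The kernel of `F` at `p` is a quaternionic subspace containing `p`. If `α_M = 0` it also
contains `M p`, so `F` vanishes at `p` unless `M p` lies on the quaternionic line of `p`. This last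
condition is polynomial in `p`; if it holds on a nonempty open set, it holds everywhere, and then
all components of `M` are zero (`eq_zero_of_lineDefect_eq_zero`). Therefore a single point with `F ≠
0` gives dimension `3 · 5 = 15`.

For the standard instanton only invariance and one nonzero curvature value need checking. Its
curvature is the pullback of an explicit form, in which right multiplication by a unit quaternion
cancels. -/

/-! ### Quaternionic linear algebra on `ℝ⁸`. -/

theorem re_qx (p : E8) : (qx p).re = p 0 := rfl
theorem imI_qx (p : E8) : (qx p).imI = -p 1 := rfl
theorem imJ_qx (p : E8) : (qx p).imJ = -p 2 := rfl
theorem imK_qx (p : E8) : (qx p).imK = -p 3 := rfl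
theorem re_qy (p : E8) : (qy p).re = p 4 := rfl
theorem imI_qy (p : E8) : (qy p).imI = -p 5 := rfl
theorem imJ_qy (p : E8) : (qy p).imJ = -p 6 := rfl
theorem imK_qy (p : E8) : (qy p).imK = -p 7 := rfl

/-- The quaternion `i`. -/
def qi : ℍ := ⟨0, 1, 0, 0⟩
/-- The quaternion `j`. -/
def qj : ℍ := ⟨0, 0, 1, 0⟩
/-- The quaternion `k`. -/
def qk : ℍ := ⟨0, 0, 0, 1⟩

@[simp] theorem re_qi : qi.re = 0 := rfl
@[simp] theorem imI_qi : qi.imI = 1 := rfl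
@[simp] theorem imJ_qi : qi.imJ = 0 := rfl
@[simp] theorem imK_qi : qi.imK = 0 := rfl
@[simp] theorem re_qj : qj.re = 0 := rfl
@[simp] theorem imI_qj : qj.imI = 0 := rfl
@[simp] theorem imJ_qj : qj.imJ = 1 := rfl
@[simp] theorem imK_qj : qj.imK = 0 := rfl
@[simp] theorem re_qk : qk.re = 0 := rfl
@[simp] theorem imI_qk : qk.imI = 0 := rfl
@[simp] theorem imJ_qk : qk.imJ = 0 := rfl
@[simp] theorem imK_qk : qk.imK = 1 := rfl

theorem qx_rightMul (q : ℍ) (p : E8) : qx (rightMul q p) = qx p * q := qx_ofQuat _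
theorem qy_rightMul (q : ℍ) (p : E8) : qy (rightMul q p) = qy p * q := qy_ofQuat _
theorem qx_quatMatrix (a b c d : ℍ) (p : E8) : qx (quatMatrix a b c d p) = a * qx p + b * qy p :=
  qx_ofQuat _
theorem qy_quatMatrix (a b c d : ℍ) (p : E8) : qy (quatMatrix a b c d p) = c * qx p + d * qy p :=
  qy_ofQuat _

theorem E8_ext {u v : E8} (hx : qx u = qx v) (hy : qy u = qy v) : u = v := by
  rw [← ofQuat_qx_qy u, ← ofQuat_qx_qy v, hx, hy]

theorem inner_eq_re (u v : E8) :
    inner ℝ u v = (qx u * star (qx v)).re + (qy u * star (qy v)).re := by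
  simp [re_qx, imI_qx, imJ_qx, imK_qx, re_qy, imI_qy, imJ_qy, imK_qy, PiLp.inner_apply,
    Fin.sum_univ_eight]
  ring

theorem rightMul_rightMul (q r : ℍ) (p : E8) : rightMul q (rightMul r p) = rightMul (r * q) p := by
  apply E8_ext <;> simp only [qx_rightMul, qy_rightMul, mul_assoc]

theorem inner_rightMul (q : ℍ) (u v : E8) :
    inner ℝ (rightMul q u) v = inner ℝ u (rightMul (star q) v) := by
  simp only [inner_eq_re, qx_rightMul, qy_rightMul, star_mul, star_star, mul_assoc]

theorem rightMul_neg (q : ℍ) (u : E8) : rightMul (-q) u = -rightMul q u := by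
  apply E8_ext <;> simp only [qx_rightMul, qy_rightMul, map_neg, mul_neg]

theorem rightMul_neg_one (u : E8) : rightMul (-1) u = -u := by
  apply E8_ext <;> simp only [qx_rightMul, qy_rightMul, map_neg, mul_neg, mul_one]

theorem I₁_eq : I₁ = rightMul (-qi) := by
  rw [I₁]; congr 1; ext <;> simp
theorem I₂_eq : I₂ = rightMul (-qj) := by
  rw [I₂]; congr 1; ext <;> simp
theorem I₃_eq : I₃ = rightMul (-qk) := by
  rw [I₃]; congr 1; ext <;> simp

theorem I₁_I₁ (u : E8) : I₁ (I₁ u) = -u := by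
  rw [I₁_eq, rightMul_rightMul, ← rightMul_neg_one]; congr 2; ext <;> simp
theorem I₂_I₂ (u : E8) : I₂ (I₂ u) = -u := by
  rw [I₂_eq, rightMul_rightMul, ← rightMul_neg_one]; congr 2; ext <;> simp
theorem I₃_I₃ (u : E8) : I₃ (I₃ u) = -u := by
  rw [I₃_eq, rightMul_rightMul, ← rightMul_neg_one]; congr 2; ext <;> simp
-- Composition of right multiplications reverses the order of the factors, and `(-j)(-i) = -k`.
theorem I₁_I₂ (u : E8) : I₁ (I₂ u) = I₃ u := by
  rw [I₁_eq, I₂_eq, I₃_eq, rightMul_rightMul]; congr 2; ext <;> simp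
theorem I₂_I₁ (u : E8) : I₂ (I₁ u) = -I₃ u := by
  rw [I₁_eq, I₂_eq, I₃_eq, rightMul_rightMul, ← rightMul_neg]; congr 2; ext <;> simp

theorem inner_I₁ (u v : E8) : inner ℝ (I₁ u) v = inner ℝ u (-I₁ v) := by
  rw [I₁_eq, inner_rightMul, ← rightMul_neg]; congr 3; ext <;> simp
theorem inner_I₂ (u v : E8) : inner ℝ (I₂ u) v = inner ℝ u (-I₂ v) := by
  rw [I₂_eq, inner_rightMul, ← rightMul_neg]; congr 3; ext <;> simp
theorem inner_I₃ (u v : E8) : inner ℝ (I₃ u) v = inner ℝ u (-I₃ v) := by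
  rw [I₃_eq, inner_rightMul, ← rightMul_neg]; congr 3; ext <;> simp

/-- Elements of `W` commute with right multiplications. -/
theorem W_rightMul {N : E8 →L[ℝ] E8} (hN : N ∈ W) (q : ℍ) (u : E8) :
    N (rightMul q u) = rightMul q (N u) := by
  obtain ⟨a, z, rfl⟩ := hN
  apply E8_ext <;>
    simp only [qx_rightMul, qy_rightMul, qx_quatMatrix, qy_quatMatrix, add_mul, mul_assoc]

/-- Elements of `W` are self-adjoint. -/
theorem inner_W {N : E8 →L[ℝ] E8} (hN : N ∈ W) (u v : E8) :
    inner ℝ (N u) v = inner ℝ u (N v) := by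
  obtain ⟨a, z, rfl⟩ := hN
  simp only [inner_eq_re, qx_quatMatrix, qy_quatMatrix]
  simp
  ring

/-! ### The Kähler forms and `Ψ₀`. -/

theorem ω₁_eq_inner (u v : E8) : ωx₁ u v + ωy₁ u v = inner ℝ (I₁ u) v := by
  rw [inner_eq_re, I₁_eq, qx_rightMul, qy_rightMul]
  simp [re_qx, imI_qx, imJ_qx, imK_qx, re_qy, imI_qy, imJ_qy, imK_qy, ωx₁, ωy₁, dx2]
  ring
theorem ω₂_eq_inner (u v : E8) : ωx₂ u v + ωy₂ u v = inner ℝ (I₂ u) v := by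
  rw [inner_eq_re, I₂_eq, qx_rightMul, qy_rightMul]
  simp [re_qx, imI_qx, imJ_qx, imK_qx, re_qy, imI_qy, imJ_qy, imK_qy, ωx₂, ωy₂, dx2]
  ring
theorem ω₃_eq_inner (u v : E8) : ωx₃ u v + ωy₃ u v = inner ℝ (I₃ u) v := by
  rw [inner_eq_re, I₃_eq, qx_rightMul, qy_rightMul]
  simp [re_qx, imI_qx, imJ_qx, imK_qx, re_qy, imI_qy, imJ_qy, imK_qy, ωx₃, ωy₃, dx2]
  ring

/-- Half of the wedge square of the 2-form `⟪J u, v⟫`. -/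
noncomputable def halfSq (J : E8 →L[ℝ] E8) (v₀ v₁ v₂ v₃ : E8) : ℝ :=
  inner ℝ (J v₀) v₁ * inner ℝ (J v₂) v₃ - inner ℝ (J v₀) v₂ * inner ℝ (J v₁) v₃
    + inner ℝ (J v₀) v₃ * inner ℝ (J v₁) v₂

/-- The square of `ω_kˣ + ω_kʸ` is `2 dx⁰¹²³ + 2 dy⁰¹²³ + 2 ω_kˣ ∧ ω_kʸ` for each `k`, so the
coefficients `1, 1, -1` leave the two volume forms with coefficient one. -/
theorem Psi0_eq (v₀ v₁ v₂ v₃ : E8) : Psi0 v₀ v₁ v₂ v₃ =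
    halfSq I₁ v₀ v₁ v₂ v₃ + halfSq I₂ v₀ v₁ v₂ v₃ - halfSq I₃ v₀ v₁ v₂ v₃ := by
  simp only [halfSq, ← ω₁_eq_inner, ← ω₂_eq_inner, ← ω₃_eq_inner, Psi0, wedge22, dx4,
    Matrix.det_succ_row_zero, Fin.sum_univ_succ]
  simp [Fin.succAbove, ωx₁, ωx₂, ωx₃, ωy₁, ωy₂, ωy₃, dx2]
  ring

/-! ### Traces of bilinear maps and contraction with `Ψ₀`. -/

section Trace

variable {V : Type*} [AddCommGroup V] [Module ℝ V]

theorem sum_inner_smul_e (u : E8) : ∑ a, inner ℝ u (e a) • e a = u := by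
  have := (EuclideanSpace.basisFun (Fin 8) ℝ).sum_repr' u
  simpa [EuclideanSpace.basisFun_apply, e, real_inner_comm] using this

theorem sum_inner_smul_apply (l : E8 →ₗ[ℝ] V) (u : E8) :
    ∑ a, inner ℝ u (e a) • l (e a) = l u := by
  conv_rhs => rw [← sum_inner_smul_e u]
  simp only [map_sum, map_smul]

/-- Moving an endomorphism to the other argument in the trace of a bilinear map. -/
theorem sum_adjoint {K K' : E8 → E8} (h : ∀ u v, inner ℝ (K u) v = inner ℝ u (K' v))
    (B : E8 →ₗ[ℝ] E8 →ₗ[ℝ] V) : ∑ a, B (K (e a)) (e a) = ∑ a, B (e a) (K' (e a)) := by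
  have h1 : ∀ a, B (K (e a)) (e a) = ∑ b, inner ℝ (K (e a)) (e b) • B (e b) (e a) := fun a =>
    (sum_inner_smul_apply (B.flip (e a)) (K (e a))).symm
  have h2 : ∀ a, B (e a) (K' (e a)) = ∑ b, inner ℝ (K' (e a)) (e b) • B (e a) (e b) := fun a =>
    (sum_inner_smul_apply (B (e a)) (K' (e a))).symm
  simp only [h1, h2]
  rw [Finset.sum_comm]
  simp only [h, real_inner_comm]

variable {J : E8 →L[ℝ] E8}

theorem sum_skew (h : ∀ u v, inner ℝ (J u) v = inner ℝ u (-J v)) (B : E8 →ₗ[ℝ] E8 →ₗ[ℝ] V) :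
    ∑ a, B (J (e a)) (e a) = -∑ a, B (e a) (J (e a)) := by
  rw [sum_adjoint (K' := fun v => -J v) h, ← Finset.sum_neg_distrib]
  simp only [map_neg]

/-- A skew `J` with `J² = -1` is orthogonal, and the trace does not depend on the orthonormal basis.
-/
theorem sum_orthogonal (h : ∀ u v, inner ℝ (J u) v = inner ℝ u (-J v)) (hJ : ∀ u, J (J u) = -u)
    (B : E8 →ₗ[ℝ] E8 →ₗ[ℝ] V) : ∑ a, B (J (e a)) (J (e a)) = ∑ a, B (e a) (e a) := by
  have := sum_skew h (B.compl₂ (J : E8 →ₗ[ℝ] E8))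
  simpa [hJ] using this

/-- The first term of `halfSq` pairs `B` with the 2-form of `J`; in the other two, the basis sums
merely reproduce `J u` and `J v`. -/
theorem sum_halfSq (J : E8 →L[ℝ] E8) (B : E8 →ₗ[ℝ] E8 →ₗ[ℝ] V) (u v : E8) :
    ∑ a, ∑ b, halfSq J u v (e a) (e b) • B (e a) (e b) =
      inner ℝ (J u) v • ∑ a, B (e a) (J (e a)) - B (J u) (J v) + B (J v) (J u) := by
  have h1 : ∀ w w' : E8, ∑ a, ∑ b, (inner ℝ w (e a) * inner ℝ w' (e b)) • B (e a) (e b) =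
      B w w' := fun w w' => by
    simp only [mul_smul, ← Finset.smul_sum, sum_inner_smul_apply]
    exact sum_inner_smul_apply (B.flip w') w
  have h2 : ∀ a, ∑ b, inner ℝ (J (e a)) (e b) • B (e a) (e b) = B (e a) (J (e a)) :=
    fun a => sum_inner_smul_apply (B (e a)) _
  simp only [halfSq, add_smul, sub_smul, Finset.sum_add_distrib, Finset.sum_sub_distrib, h1]
  simp only [mul_smul, ← Finset.smul_sum, h2]
  rw [← h1 (J v) (J u)]
  simp only [mul_smul]
  congr 1
  refine Finset.sum_congr rfl fun a _ => Finset.sum_congr rfl fun b _ => smul_comm _ _ _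

/-- `Ψ₀` acts as `-2` on 2-forms that are eigenvectors of the actions of `I₁, I₂, I₃` with suitable
eigenvalues and are orthogonal to the three Kähler forms. -/
theorem sum_Psi0 (B : E8 →ₗ[ℝ] E8 →ₗ[ℝ] V) (hB : ∀ u v, B u v = -B v u) {s₁ s₂ s₃ : ℝ}
    (hs : s₁ + s₂ - s₃ = 1)
    (h1 : ∀ u v, B (I₁ u) (I₁ v) = s₁ • B u v) (h2 : ∀ u v, B (I₂ u) (I₂ v) = s₂ • B u v)
    (h3 : ∀ u v, B (I₃ u) (I₃ v) = s₃ • B u v) (t1 : ∑ a, B (e a) (I₁ (e a)) = 0)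
    (t2 : ∑ a, B (e a) (I₂ (e a)) = 0) (t3 : ∑ a, B (e a) (I₃ (e a)) = 0) (u v : E8) :
    ∑ a, ∑ b, Psi0 u v (e a) (e b) • B (e a) (e b) = (-2 : ℝ) • B u v := by
  -- The trace terms drop out and each `J = I_k` contributes `-B(J u, J v) + B(J v, J u) = -2 s_k
  -- B(u, v)`.
  simp only [Psi0_eq, add_smul, sub_smul, Finset.sum_add_distrib, Finset.sum_sub_distrib,
    sum_halfSq, t1, t2, t3, h1, h2, h3, hB v u]
  have : s₃ = s₁ + s₂ - 1 := by linarith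
  rw [this]
  module

end Trace

/-! ### Calculus and the curvature of a conical connection. -/

open Filter Topology in
/-- The derivative of a function with values in a closed subspace lies in that subspace. -/
theorem fderiv_mem_of_eventually_mem {E V : Type*} [NormedAddCommGroup E] [NormedSpace ℝ E]
    [NormedAddCommGroup V] [NormedSpace ℝ V] {S : Submodule ℝ V} (hS : IsClosed (S : Set V))
    {f : E → V} {p : E} (hf : DifferentiableAt ℝ f p) (h : ∀ᶠ q in 𝓝 p, f q ∈ S) (u : E) :
    fderiv ℝ f p u ∈ S := by
  have h1 := hf.hasFDerivAt.lim_real u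
  have h2 : Tendsto (fun c : ℝ => p + c⁻¹ • u) atTop (𝓝 p) := by
    have := (tendsto_inv_atTop_zero (𝕜 := ℝ)).smul_const u
    simpa using this.const_add p
  refine hS.mem_of_tendsto h1 ?_
  filter_upwards [h2.eventually h] with c hc
  exact S.smul_mem _ (S.sub_mem hc h.self_of_nhds)

theorem fderiv_clm_apply_const {E V W : Type*} [NormedAddCommGroup E] [NormedSpace ℝ E]
    [NormedAddCommGroup V] [NormedSpace ℝ V] [NormedAddCommGroup W] [NormedSpace ℝ W]
    {f : E → V →L[ℝ] W} {p : E} (hf : DifferentiableAt ℝ f p) (u : E) (v : V) :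
    fderiv ℝ (fun q => f q v) p u = fderiv ℝ f p u v := by
  rw [fderiv_clm_apply hf (differentiableAt_const v)]
  simp

namespace ConicalConnection

variable {𝔸 : Type*} [NormedRing 𝔸] [NormedAlgebra ℝ 𝔸] {G : LinearLieGroup 𝔸} {ι : Type*}

/-- The curvature as a continuous bilinear map. -/
noncomputable def curv (A : ConicalConnection G ι) (i : ι) (p : E8) : E8 →L[ℝ] E8 →L[ℝ] 𝔸 :=
  let L := (ContinuousLinearMap.mul ℝ 𝔸).bilinearComp (A.A i p) (A.A i p)
  fderiv ℝ (A.A i) p - (fderiv ℝ (A.A i) p).flip + (L - L.flip)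

/-- The covariant derivative `(∇_w F)(u, v)` of the curvature. -/
noncomputable def covCurv (A : ConicalConnection G ι) (i : ι) (p w u v : E8) : 𝔸 :=
  fderiv ℝ (A.curv i) p w u v + (A.A i p w * A.curv i p u v - A.curv i p u v * A.A i p w)

variable (A : ConicalConnection G ι) {i j : ι} {p : E8}

theorem curv_apply (i : ι) (p u v : E8) : A.curv i p u v = A.F i p u v := by
  simp [curv, F]

theorem curv_swap (i : ι) (p u v : E8) : A.curv i p u v = -A.curv i p v u := by
  simp only [curv_apply, F]; abel

theorem alpha_apply (hp : p ∈ A.U i) (M : E8 →L[ℝ] E8) (v : E8) :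
    A.alpha M i p v = A.curv i p (M p) v := by
  simp [alpha, hp, curv_apply]

theorem contDiffOn_fderiv_A (i : ι) : ContDiffOn ℝ ∞ (fderiv ℝ (A.A i)) (A.U i) :=
  (A.A_smooth i).fderiv_of_isOpen (A.isOpen_U i) (by simp)

theorem contDiffOn_curv (i : ι) : ContDiffOn ℝ ∞ (A.curv i) (A.U i) := by
  rw [contDiffOn_clm_apply]
  intro u
  rw [contDiffOn_clm_apply]
  intro v
  simp only [curv_apply, F]
  have hA := A.A_smooth i
  have hD := A.contDiffOn_fderiv_A i
  have h1 : ∀ u, ContDiffOn ℝ ∞ (fun q => A.A i q u) (A.U i) :=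
    fun u => hA.clm_apply contDiffOn_const
  have h2 : ∀ u v, ContDiffOn ℝ ∞ (fun q => fderiv ℝ (A.A i) q u v) (A.U i) :=
    fun u v => (hD.clm_apply contDiffOn_const).clm_apply contDiffOn_const
  exact ((h2 u v).sub (h2 v u)).add (((h1 u).mul (h1 v)).sub ((h1 v).mul (h1 u)))

theorem contDiffOn_alpha (M : E8 →L[ℝ] E8) (i : ι) : ContDiffOn ℝ ∞ (A.alpha M i) (A.U i) := by
  rw [contDiffOn_clm_apply]
  intro v
  have h : ContDiffOn ℝ ∞ (fun q => A.curv i q (M q) v) (A.U i) :=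
    ((A.contDiffOn_curv i).clm_apply M.contDiff.contDiffOn).clm_apply contDiffOn_const
  exact h.congr fun q hq => A.alpha_apply hq M v

theorem eventually_mem (hp : p ∈ A.U i) : ∀ᶠ q in nhds p, q ∈ A.U i := (A.isOpen_U i).mem_nhds hp

theorem differentiableAt_A (hp : p ∈ A.U i) : DifferentiableAt ℝ (A.A i) p :=
  A.differentiableAt_of_mem (A.A_smooth i) hp

theorem differentiableAt_curv (hp : p ∈ A.U i) : DifferentiableAt ℝ (A.curv i) p :=
  A.differentiableAt_of_mem (A.contDiffOn_curv i) hp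

theorem fderiv_curv_apply (hp : p ∈ A.U i) (w u v : E8) :
    fderiv ℝ (fun q => A.curv i q u v) p w = fderiv ℝ (A.curv i) p w u v := by
  have h := A.differentiableAt_curv hp
  rw [fderiv_clm_apply_const (h.clm_apply (differentiableAt_const u)), fderiv_clm_apply_const h]

theorem fderiv_fderiv_A_comm (hp : p ∈ A.U i) (u v : E8) :
    fderiv ℝ (fderiv ℝ (A.A i)) p u v = fderiv ℝ (fderiv ℝ (A.A i)) p v u := by
  have h : ContDiffAt ℝ ∞ (A.A i) p := (A.A_smooth i).contDiffAt (A.eventually_mem hp)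
  exact (h.isSymmSndFDerivAt (by rw [minSmoothness_of_isRCLikeNormedField]; exact ENat.LEInfty.out)).eq u v

/-- The Bianchi identity `D_A F_A = 0`. -/
theorem bianchi (hp : p ∈ A.U i) (u v w : E8) :
    A.covCurv i p u v w + A.covCurv i p v w u + A.covCurv i p w u v = 0 := by
  have hA := (A.differentiableAt_A hp).hasFDerivAt
  have hD := (A.differentiableAt_of_mem (A.contDiffOn_fderiv_A i) hp).hasFDerivAt
  have h1 : ∀ u, HasFDerivAt (fun q => A.A i q u) _ p :=
    fun u => hA.clm_apply (hasFDerivAt_const u p)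
  have h2 : ∀ u v, HasFDerivAt (fun q => fderiv ℝ (A.A i) q u v) _ p :=
    fun u v => (hD.clm_apply (hasFDerivAt_const u p)).clm_apply (hasFDerivAt_const v p)
  have key : ∀ w u v, fderiv ℝ (A.curv i) p w u v =
      fderiv ℝ (fderiv ℝ (A.A i)) p w u v - fderiv ℝ (fderiv ℝ (A.A i)) p w v u +
      (A.A i p u * fderiv ℝ (A.A i) p w v + fderiv ℝ (A.A i) p w u * A.A i p v
        - (A.A i p v * fderiv ℝ (A.A i) p w u + fderiv ℝ (A.A i) p w v * A.A i p u)) := by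
    intro w u v
    rw [← A.fderiv_curv_apply hp]
    simp only [curv_apply, F]
    have := ((h2 u v).sub (h2 v u)).add (((h1 u).mul' (h1 v)).sub ((h1 v).mul' (h1 u)))
    refine (congrArg (fun l => l w) this.fderiv).trans ?_
    simp
  simp only [covCurv, key, curv_apply, F]
  -- Symmetry of the second derivatives cancels the `ddA` terms; the rest is the Jacobi identity
  -- together with cancelling terms in `dA` and `A`.
  rw [A.fderiv_fderiv_A_comm hp v u, A.fderiv_fderiv_A_comm hp w u,
    A.fderiv_fderiv_A_comm hp w v]
  noncomm_ring

/-- Euler's relation: the coefficients of `A` are homogeneous of degree `-1`. -/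
theorem fderiv_A_self (hp : p ∈ A.U i) : fderiv ℝ (A.A i) p p = -A.A i p := by
  have h1 : HasDerivAt (fun t : ℝ => t • p) p 1 := by
    simpa using (hasDerivAt_id (1 : ℝ)).smul_const p
  have h2 : HasFDerivAt (A.A i) (fderiv ℝ (A.A i) p) ((1 : ℝ) • p) := by
    rw [one_smul]; exact (A.differentiableAt_A hp).hasFDerivAt
  have h3 := (hasDerivAt_id (1 : ℝ)).smul (h2.comp_hasDerivAt 1 h1)
  have h4 : HasDerivAt (fun _ : ℝ => A.A i p) 0 1 := hasDerivAt_const _ _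
  have h5 : (fun t : ℝ => id t • (A.A i ∘ fun t : ℝ => t • p) t) =ᶠ[nhds 1] fun _ => A.A i p := by
    filter_upwards [lt_mem_nhds (zero_lt_one (α := ℝ))] with t ht
    exact A.A_conical i p hp t ht
  have h6 := (h3.congr_of_eventuallyEq h5.symm).unique h4
  simp at h6
  exact eq_neg_of_add_eq_zero_left h6

/-- Obtained by differentiating `A_q(q) = 0` in the direction `v`. -/
theorem fderiv_A_apply_self (hp : p ∈ A.U i) (v : E8) :
    fderiv ℝ (A.A i) p v p = -A.A i p v := by
  have h := (A.differentiableAt_A hp).hasFDerivAt.clm_apply (hasFDerivAt_id p)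
  have h' : (fun q => A.A i q (id q)) =ᶠ[nhds p] fun _ => 0 := by
    filter_upwards [A.eventually_mem hp] with q hq
    exact A.A_radial i q hq
  have := congrArg (fun l => l v)
    ((h.congr_of_eventuallyEq h'.symm).unique (hasFDerivAt_const (0 : 𝔸) p))
  simp at this
  exact eq_neg_of_add_eq_zero_right this

/-- The curvature is annihilated by the radial vector field. -/
theorem curv_self (hp : p ∈ A.U i) (v : E8) : A.curv i p p v = 0 := by
  rw [curv_apply, F, A.fderiv_A_self hp, A.fderiv_A_apply_self hp, A.A_radial i p hp]
  simp

/-- Differentiating `F_q(q, v) = 0` in the direction `w` also hits the argument `q`, which produces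
`F(w, v)`. This is the term that later cancels against `F(M p, v)`. -/
theorem covCurv_self (hp : p ∈ A.U i) (w v : E8) :
    A.covCurv i p w p v = -A.curv i p w v := by
  have h := ((A.differentiableAt_curv hp).hasFDerivAt.clm_apply (hasFDerivAt_id p)).clm_apply
    (hasFDerivAt_const v p)
  have h' : (fun q => A.curv i q (id q) v) =ᶠ[nhds p] fun _ => 0 := by
    filter_upwards [A.eventually_mem hp] with q hq
    exact A.curv_self hq v
  have := congrArg (fun l => l w)
    ((h.congr_of_eventuallyEq h'.symm).unique (hasFDerivAt_const (0 : 𝔸) p))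
  simp at this
  rw [covCurv, A.curv_self hp]
  simp
  exact eq_neg_of_add_eq_zero_right this

theorem covCurv_swap (hp : p ∈ A.U i) (w u v : E8) :
    A.covCurv i p w u v = -A.covCurv i p w v u := by
  have : fderiv ℝ (A.curv i) p w u v = -fderiv ℝ (A.curv i) p w v u := by
    rw [← A.fderiv_curv_apply hp, ← A.fderiv_curv_apply hp,
      show (fun q => A.curv i q u v) = fun q => -A.curv i q v u from
        funext fun q => A.curv_swap i q u v, fderiv_fun_neg]
    rfl
  rw [covCurv, covCurv, this, A.curv_swap i p u v]
  noncomm_ring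

theorem curv_conical (hp : p ∈ A.U i) {t : ℝ} (ht : 0 < t) (u v : E8) :
    t • t • A.curv i (t • p) u v = A.curv i p u v := by
  have hD : t • t • fderiv ℝ (A.A i) (t • p) = fderiv ℝ (A.A i) p := by
    have h : (fun q => t • A.A i (t • q)) =ᶠ[nhds p] A.A i := by
      filter_upwards [A.eventually_mem hp] with q hq
      exact A.A_conical i q hq t ht
    rw [← h.fderiv_eq, ← fderiv_comp_smul]
    have := invertibleOfNonzero ht.ne'
    exact (fderiv_const_smul_of_invertible t (f := fun q => A.A i (t • q))).symm
  rw [curv_apply, curv_apply, F, F, ← hD, ← A.A_conical i p hp t ht]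
  simp only [smul_apply, smul_add, smul_sub, smul_mul_smul_comm, mul_smul]

/-- The curvature transforms by conjugation under changes of trivialization. -/
theorem curv_gauge (hp : p ∈ A.U i ∩ A.U j) (u v : E8) : A.curv i p u v =
    (A.g i j p : 𝔸) * A.curv j p u v * ((A.g i j p)⁻¹ : 𝔸ˣ) := by
  have hopen : IsOpen (A.U i ∩ A.U j) := (A.isOpen_U i).inter (A.isOpen_U j)
  set g : E8 → 𝔸 := fun q => (A.g i j q : 𝔸) with hg
  have hgs : ContDiffOn ℝ ∞ g (A.U i ∩ A.U j) := A.g_smooth i j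
  have hgd : HasFDerivAt g _ p :=
    ((hgs.contDiffAt (hopen.mem_nhds hp)).differentiableAt (by simp)).hasFDerivAt
  have hgD : HasFDerivAt (fderiv ℝ g) _ p :=
    (((hgs.fderiv_of_isOpen hopen (m := ∞) (by simp)).contDiffAt
      (hopen.mem_nhds hp)).differentiableAt (by simp)).hasFDerivAt
  have hsymm : fderiv ℝ (fderiv ℝ g) p u v = fderiv ℝ (fderiv ℝ g) p v u :=
    ((hgs.contDiffAt (hopen.mem_nhds hp)).isSymmSndFDerivAt (by rw [minSmoothness_of_isRCLikeNormedField]; exact ENat.LEInfty.out)).eq u v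
  have hAi := (A.differentiableAt_A hp.1).hasFDerivAt
  have hAj := (A.differentiableAt_A hp.2).hasFDerivAt
  -- Clearing `g⁻¹` from the gauge relation avoids having to differentiate an inverse.
  have h0 : ∀ q ∈ A.U i ∩ A.U j, ∀ v, A.A i q v * g q = g q * A.A j q v - fderiv ℝ g q v := by
    intro q hq v
    rw [A.A_gauge i j q hq v, sub_mul, mul_assoc, mul_assoc _ _ (g q)]
    simp [hg]
  have h1 : ∀ u v, A.A i p v * fderiv ℝ g p u + fderiv ℝ (A.A i) p u v * g p =
      g p * fderiv ℝ (A.A j) p u v + fderiv ℝ g p u * A.A j p v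
        - fderiv ℝ (fderiv ℝ g) p u v := by
    intro u v
    have hl := (hAi.clm_apply (hasFDerivAt_const v p)).mul' hgd
    have hr := (hgd.mul' (hAj.clm_apply (hasFDerivAt_const v p))).sub
      (hgD.clm_apply (hasFDerivAt_const v p))
    have hev : (fun q => A.A i q v * g q) =ᶠ[nhds p]
        fun q => g q * A.A j q v - fderiv ℝ g q v := by
      filter_upwards [hopen.mem_nhds hp] with q hq
      exact h0 q hq v
    have := congrArg (fun l => l u) ((hr.congr_of_eventuallyEq hev).unique hl)
    simpa using this.symm
  have hd : ∀ v, fderiv ℝ g p v = g p * A.A j p v - A.A i p v * g p := fun v => by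
    rw [h0 p hp v]; abel
  suffices h : A.curv i p u v * g p = g p * A.curv j p u v by
    rw [← h, mul_assoc]; simp [hg]
  have e1 := h1 u v
  have e2 := h1 v u
  -- Antisymmetrizing in `u, v` removes the second derivative of `g`.
  have e3 : fderiv ℝ (A.A i) p u v * g p - fderiv ℝ (A.A i) p v u * g p =
      g p * fderiv ℝ (A.A j) p u v + fderiv ℝ g p u * A.A j p v - A.A i p v * fderiv ℝ g p u
        - (g p * fderiv ℝ (A.A j) p v u + fderiv ℝ g p v * A.A j p u
            - A.A i p u * fderiv ℝ g p v) := by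
    rw [eq_sub_of_add_eq' e1, eq_sub_of_add_eq' e2, hsymm]; abel
  rw [curv_apply, curv_apply, F, F, add_mul, sub_mul, e3, hd, hd]
  noncomm_ring

/-- Finite dimension makes the Lie algebra closed, so that derivatives of functions with values in
it stay in it. -/
theorem curv_mem [FiniteDimensional ℝ 𝔸] (hp : p ∈ A.U i) (u v : E8) :
    A.curv i p u v ∈ G.lie := by
  have hD : ∀ u v, fderiv ℝ (A.A i) p u v ∈ G.lie := fun u v => by
    have h := A.differentiableAt_A hp
    rw [← fderiv_clm_apply_const h]
    refine fderiv_mem_of_eventually_mem G.lie.closed_of_finiteDimensional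
      (h.clm_apply (differentiableAt_const v)) ?_ u
    filter_upwards [A.eventually_mem hp] with q hq
    exact A.A_mem i q hq v
  rw [curv_apply]
  exact G.lie.add_mem (G.lie.sub_mem (hD u v) (hD v u))
    (G.commutator_mem _ (A.A_mem i p hp u) _ (A.A_mem i p hp v))

theorem alpha_mem_Omega1 [FiniteDimensional ℝ 𝔸] (M : E8 →L[ℝ] E8) : A.alpha M ∈ A.Omega1 := by
  refine ⟨A.contDiffOn_alpha M, fun i p hp => by simp [alpha, hp], fun i p hp v => ?_,
    fun i p hp => ?_, fun i p hp t ht => ?_, fun i j p hp v => ?_⟩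
  · rw [A.alpha_apply hp]; exact A.curv_mem hp _ _
  · rw [A.alpha_apply hp, A.curv_swap, A.curv_self hp, neg_zero]
  · ext v
    rw [smul_apply, A.alpha_apply (A.cone i p hp t ht), A.alpha_apply hp, map_smul, map_smul, smul_apply,
      A.curv_conical hp ht]
  · rw [A.alpha_apply hp.1, A.alpha_apply hp.2, A.curv_gauge hp]

end ConicalConnection

/-! ### Curvature invariant under the complex structures: Yang–Mills and the kernel equations. -/

theorem I₁_I₃ (u : E8) : I₁ (I₃ u) = -I₃ (I₁ u) := by
  simp only [← I₁_I₂, I₂_I₁, map_neg, neg_neg]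
theorem I₂_I₃ (u : E8) : I₂ (I₃ u) = -I₃ (I₂ u) := by
  simp only [← I₁_I₂, I₂_I₂, map_neg, neg_neg]
  rw [I₂_I₁, ← I₁_I₂, I₂_I₂, map_neg, neg_neg]

theorem I₃_I₁ (u : E8) : I₃ (I₁ u) = -I₁ (I₃ u) := by rw [I₁_I₃, neg_neg]
theorem I₃_I₂ (u : E8) : I₃ (I₂ u) = -I₂ (I₃ u) := by rw [I₂_I₃, neg_neg]
theorem I₁_I₂' (u : E8) : I₁ (I₂ u) = -I₂ (I₁ u) := by rw [I₁_I₂, I₂_I₁, neg_neg]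
theorem I₂_I₁' (u : E8) : I₂ (I₁ u) = -I₁ (I₂ u) := by rw [I₁_I₂, I₂_I₁]

theorem W_I₁ {N : E8 →L[ℝ] E8} (hN : N ∈ W) (u : E8) : N (I₁ u) = I₁ (N u) := W_rightMul hN _ u
theorem W_I₂ {N : E8 →L[ℝ] E8} (hN : N ∈ W) (u : E8) : N (I₂ u) = I₂ (N u) := W_rightMul hN _ u
theorem W_I₃ {N : E8 →L[ℝ] E8} (hN : N ∈ W) (u : E8) : N (I₃ u) = I₃ (N u) := W_rightMul hN _ u

theorem eq_zero_of_eq_neg {V : Type*} [AddCommGroup V] [Module ℝ V] {x : V} (h : x = -x) :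
    x = 0 := by
  have h2 : (2 : ℝ) • x = 0 := by rw [two_smul]; nth_rewrite 1 [h]; exact neg_add_cancel x
  exact (smul_eq_zero.mp h2).resolve_left two_ne_zero

/-- A bilinear map invariant under a complex structure `J` is orthogonal to every endomorphism
that anticommutes with `J`. -/
theorem sum_eq_zero_of_anticomm {V : Type*} [AddCommGroup V] [Module ℝ V] {J K : E8 →L[ℝ] E8}
    (h : ∀ u v, inner ℝ (J u) v = inner ℝ u (-J v)) (hJ : ∀ u, J (J u) = -u)
    (hK : ∀ u, K (J u) = -J (K u)) (B : E8 →ₗ[ℝ] E8 →ₗ[ℝ] V)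
    (hB : ∀ u v, B (J u) (J v) = B u v) : ∑ a, B (e a) (K (e a)) = 0 := by
  -- Replacing `e a` by `J (e a)` preserves the sum, but `B(J e, K J e) = -B(J e, J K e) = -B(e, K
  -- e)`.
  have := sum_orthogonal h hJ (B.compl₂ (K : E8 →ₗ[ℝ] E8))
  simp [hK, hB] at this
  exact eq_zero_of_eq_neg this.symm

namespace ConicalConnection

variable {𝔸 : Type*} [NormedRing 𝔸] [NormedAlgebra ℝ 𝔸] {G : LinearLieGroup 𝔸} {ι : Type*}

/-- The curvature is invariant under the endomorphism `J`. -/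
def CurvInvariant (A : ConicalConnection G ι) (J : E8 →L[ℝ] E8) : Prop :=
  ∀ i, ∀ p ∈ A.U i, ∀ u v, A.curv i p (J u) (J v) = A.curv i p u v

variable (A : ConicalConnection G ι) {i : ι} {p : E8}

/-- The curvature at a point as a bilinear map. -/
noncomputable def curvLin (i : ι) (p : E8) : E8 →ₗ[ℝ] E8 →ₗ[ℝ] 𝔸 :=
  LinearMap.mk₂ ℝ (fun u v => A.curv i p u v) (by simp) (by simp) (by simp) (by simp)

@[simp] theorem curvLin_apply (u v : E8) : A.curvLin i p u v = A.curv i p u v := rfl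

/-- The covariant derivative of the curvature in a given direction. -/
noncomputable def covCurvLin (i : ι) (p w : E8) : E8 →ₗ[ℝ] E8 →ₗ[ℝ] 𝔸 :=
  LinearMap.mk₂ ℝ (fun u v => A.covCurv i p w u v)
    (fun _ _ _ => by simp only [covCurv, map_add, add_apply, mul_add, add_mul]; abel)
    (fun _ _ _ => by
      simp only [covCurv, map_smul, smul_apply, mul_smul_comm, smul_mul_assoc, smul_add, smul_sub])
    (fun _ _ _ => by simp only [covCurv, map_add, mul_add, add_mul]; abel)
    (fun _ _ _ => by
      simp only [covCurv, map_smul, mul_smul_comm, smul_mul_assoc, smul_add, smul_sub])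

@[simp] theorem covCurvLin_apply (w u v : E8) :
    A.covCurvLin i p w u v = A.covCurv i p w u v := rfl

/-- The covariant derivative of the curvature, with the last argument fixed. -/
noncomputable def covCurvLinLeft (i : ι) (p v : E8) : E8 →ₗ[ℝ] E8 →ₗ[ℝ] 𝔸 :=
  LinearMap.mk₂ ℝ (fun w u => A.covCurv i p w u v)
    (fun _ _ _ => by simp only [covCurv, map_add, add_apply, mul_add, add_mul]; abel)
    (fun _ _ _ => by
      simp only [covCurv, map_smul, smul_apply, mul_smul_comm, smul_mul_assoc, smul_add, smul_sub])
    (fun _ _ _ => by simp only [covCurv, map_add, add_apply, mul_add, add_mul]; abel)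
    (fun _ _ _ => by
      simp only [covCurv, map_smul, smul_apply, mul_smul_comm, smul_mul_assoc, smul_add, smul_sub])

variable {A}

/-- `J` is constant on `ℝ⁸`, so the flat covariant derivative preserves the invariance. -/
theorem CurvInvariant.covCurv {J : E8 →L[ℝ] E8} (h : A.CurvInvariant J) (hp : p ∈ A.U i)
    (w u v : E8) : A.covCurv i p w (J u) (J v) = A.covCurv i p w u v := by
  have h1 : (fun q => A.curv i q (J u) (J v)) =ᶠ[nhds p] fun q => A.curv i q u v := by
    filter_upwards [A.eventually_mem hp] with q hq
    exact h i q hq u v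
  rw [ConicalConnection.covCurv, ConicalConnection.covCurv, ← A.fderiv_curv_apply hp,
    ← A.fderiv_curv_apply hp, h1.fderiv_eq, h i p hp]

/-- The Yang--Mills equation, for curvature invariant under two anticommuting complex structures. -/
theorem sum_covCurv (h1 : A.CurvInvariant I₁) (h2 : A.CurvInvariant I₂) (hp : p ∈ A.U i)
    (v : E8) : ∑ a, A.covCurv i p (e a) (e a) v = 0 := by
  -- The Bianchi identity is traced against `I₁`. The term with `∇_w` vanishes, because `I₁`
  -- anticommutes with `I₂`, and the other two are equal, because `I₁` is skew.
  have key : ∀ w, ∑ a, A.covCurv i p (e a) (I₁ (e a)) w = 0 := by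
    intro w
    have t1 : ∑ a, A.covCurv i p w (e a) (I₁ (e a)) = 0 :=
      sum_eq_zero_of_anticomm inner_I₂ I₂_I₂ I₁_I₂' (A.covCurvLin i p w) (h2.covCurv hp w)
    have t2 : ∑ a, A.covCurv i p (I₁ (e a)) (e a) w = -∑ a, A.covCurv i p (e a) (I₁ (e a)) w :=
      sum_skew inner_I₁ (A.covCurvLinLeft i p w)
    have t3 : ∑ a, (A.covCurv i p (e a) (I₁ (e a)) w + A.covCurv i p (I₁ (e a)) w (e a)
        + A.covCurv i p w (e a) (I₁ (e a))) = 0 :=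
      Finset.sum_eq_zero fun a _ => A.bianchi hp _ _ _
    simp only [Finset.sum_add_distrib, t1, A.covCurv_swap hp _ w, Finset.sum_neg_distrib, t2,
      neg_neg, add_zero] at t3
    exact eq_zero_of_eq_neg (eq_neg_of_add_eq_zero_left t3)
  -- Invariance under `I₁` turns `F(I₁ eₐ, I₁ v)` back into `F(eₐ, v)`.
  have := key (I₁ v)
  simpa only [h1.covCurv hp] using this

variable (A)

theorem cov1_alpha (hp : p ∈ A.U i) (M : E8 →L[ℝ] E8) (u v : E8) :
    A.cov1 (A.alpha M) i p u v = A.covCurv i p u (M p) v + A.curv i p (M u) v := by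
  have h := ((A.differentiableAt_curv hp).hasFDerivAt.clm_apply M.hasFDerivAt).clm_apply
    (hasFDerivAt_const v p)
  have h' : (fun q => A.alpha M i q v) =ᶠ[nhds p] fun q => A.curv i q (M q) v := by
    filter_upwards [A.eventually_mem hp] with q hq
    exact A.alpha_apply hq M v
  have h2 := congrArg (fun l => l u) (h.congr_of_eventuallyEq h').fderiv
  rw [cov1, ← fderiv_clm_apply_const (A.differentiableAt_of_mem (A.contDiffOn_alpha M i) hp),
    A.alpha_apply hp, covCurv, h2]
  simp
  abel

/-- The curvature 2-form `F(M u, v) + F(u, M v)`. -/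
noncomputable def curvDer (i : ι) (p : E8) (M : E8 →L[ℝ] E8) : E8 →ₗ[ℝ] E8 →ₗ[ℝ] 𝔸 :=
  (A.curvLin i p) ∘ₗ (M : E8 →ₗ[ℝ] E8) + (A.curvLin i p).compl₂ (M : E8 →ₗ[ℝ] E8)

theorem curvDer_apply (M : E8 →L[ℝ] E8) (u v : E8) :
    A.curvDer i p M u v = A.curv i p (M u) v + A.curv i p u (M v) := by
  simp [curvDer]

theorem curvDer_swap (M : E8 →L[ℝ] E8) (u v : E8) :
    A.curvDer i p M u v = -A.curvDer i p M v u := by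
  rw [curvDer_apply, curvDer_apply, A.curv_swap i p (M u), A.curv_swap i p u]; abel

/-- A covariant Cartan formula: since `D_A F = 0`, the exterior derivative of `X_M ⌟ F` is the Lie
derivative of `F` along `X_M`. It splits into the derivative in the direction `M p` and the linear
action of `M` on the two arguments. -/
theorem extCov1_alpha (hp : p ∈ A.U i) (M : E8 →L[ℝ] E8) (u v : E8) :
    A.extCov1 (A.alpha M) i p u v = A.covCurv i p (M p) u v + A.curvDer i p M u v := by
  have h := A.bianchi hp u (M p) v
  rw [extCov1, A.cov1_alpha hp, A.cov1_alpha hp, curvDer_apply, A.curv_swap i p u (M v)]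
  rw [A.covCurv_swap hp (M p) v u, A.covCurv_swap hp v u (M p)] at h
  rw [show A.covCurv i p u (M p) v = A.covCurv i p (M p) u v + A.covCurv i p v (M p) u by
    rw [← sub_eq_zero, ← h]; abel]
  abel

variable {A}

/-- The trace of `∇α_M` splits into the divergence of `F`, zero by Yang–Mills, and the trace assumed
to vanish. The radial correction vanishes because `F` annihilates `p`. -/
theorem codiff_alpha (h1 : A.CurvInvariant I₁) (h2 : A.CurvInvariant I₂) (hp : p ∈ A.U i)
    {M : E8 →L[ℝ] E8} (hM : ∑ a, A.curv i p (M (e a)) (e a) = 0) :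
    A.codiff (A.alpha M) i p = 0 := by
  simp only [codiff, A.cov1_alpha hp, Finset.sum_add_distrib, hM]
  simp only [A.covCurv_swap hp _ (M p), Finset.sum_neg_distrib, sum_covCurv h1 h2 hp,
    A.covCurv_self hp, A.curv_swap i p (M p), A.curv_self hp]
  simp

theorem curvDer_invariant {J M : E8 →L[ℝ] E8} (h : A.CurvInvariant J) (hp : p ∈ A.U i) {s : ℝ}
    (hM : ∀ u, M (J u) = s • J (M u)) (u v : E8) :
    A.curvDer i p M (J u) (J v) = s • A.curvDer i p M u v := by
  simp only [curvDer_apply, hM, map_smul, smul_apply, h i p hp, smul_add]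

/-- Both pieces of `D_A α_M` are eigenvectors of contraction with `Ψ₀` for the eigenvalue `-2`, so
the result is minus the contraction of `D_A α_M` with `p`. -/
theorem phiD_alpha (h1 : A.CurvInvariant I₁) (h2 : A.CurvInvariant I₂) (h3 : A.CurvInvariant I₃)
    (hp : p ∈ A.U i) {M : E8 →L[ℝ] E8} {s₁ s₂ s₃ : ℝ} (hs : s₁ + s₂ - s₃ = 1)
    (hM1 : ∀ u, M (I₁ u) = s₁ • I₁ (M u)) (hM2 : ∀ u, M (I₂ u) = s₂ • I₂ (M u))
    (hM3 : ∀ u, M (I₃ u) = s₃ • I₃ (M u)) (t1 : ∑ a, A.curvDer i p M (e a) (I₁ (e a)) = 0)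
    (t2 : ∑ a, A.curvDer i p M (e a) (I₂ (e a)) = 0)
    (t3 : ∑ a, A.curvDer i p M (e a) (I₃ (e a)) = 0) (v : E8) :
    A.phiD (A.alpha M) i p v = 0 := by
  have e1 := sum_Psi0 (A.curvDer i p M) (A.curvDer_swap M) hs (curvDer_invariant h1 hp hM1)
    (curvDer_invariant h2 hp hM2) (curvDer_invariant h3 hp hM3) t1 t2 t3 p v
  have e2 := sum_Psi0 (A.covCurvLin i p (M p)) (A.covCurv_swap hp (M p))
    (s₁ := 1) (s₂ := 1) (s₃ := 1) (by norm_num)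
    (by simpa using h1.covCurv hp (M p)) (by simpa using h2.covCurv hp (M p))
    (by simpa using h3.covCurv hp (M p))
    (sum_eq_zero_of_anticomm inner_I₂ I₂_I₂ I₁_I₂' _ (h2.covCurv hp (M p)))
    (sum_eq_zero_of_anticomm inner_I₁ I₁_I₁ I₂_I₁' _ (h1.covCurv hp (M p)))
    (sum_eq_zero_of_anticomm inner_I₁ I₁_I₁ I₃_I₁ _ (h1.covCurv hp (M p))) p v
  simp only [covCurvLin_apply] at e2
  simp only [phiD, A.extCov1_alpha hp, smul_add, Finset.sum_add_distrib, phiStd, e1, e2]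
  -- Contracted with `p`, the pieces are `-F(M p, v)` and `F(M p, v) + F(p, M v)`, and `F(p, M v) =
  -- 0`.
  rw [curvDer_apply, A.covCurv_self hp, A.curv_self hp]
  module

/-- The trace of a skew form against a self-adjoint endomorphism is zero. -/
theorem sum_curv_W {N : E8 →L[ℝ] E8} (hN : N ∈ W) : ∑ a, A.curv i p (N (e a)) (e a) = 0 := by
  have h : ∑ a, A.curv i p (N (e a)) (e a) = ∑ a, A.curv i p (e a) (N (e a)) :=
    sum_adjoint (inner_W hN) (A.curvLin i p)
  refine eq_zero_of_eq_neg (h.trans ?_)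
  rw [← Finset.sum_neg_distrib]
  exact Finset.sum_congr rfl fun a _ => A.curv_swap i p _ _

theorem sum_curv_anticomm {J M : E8 →L[ℝ] E8} (h : A.CurvInvariant J) (hp : p ∈ A.U i)
    (hi : ∀ u v, inner ℝ (J u) v = inner ℝ u (-J v)) (hJ : ∀ u, J (J u) = -u)
    (hM : ∀ u, M (J u) = -J (M u)) : ∑ a, A.curv i p (M (e a)) (e a) = 0 := by
  have := sum_eq_zero_of_anticomm hi hJ hM (A.curvLin i p) (h i p hp)
  simp only [curvLin_apply, A.curv_swap i p (e _), Finset.sum_neg_distrib, neg_eq_zero] at this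
  exact this

/-- The trace of `curvDer` against `J`, for `N` in `W` composed with `J`. -/
theorem sum_curvDer_comp {J N : E8 →L[ℝ] E8} (h : A.CurvInvariant J) (hp : p ∈ A.U i)
    (hN : N ∈ W) (hJ : ∀ u, J (J u) = -u) (hNJ : ∀ u, N (J u) = J (N u)) :
    ∑ a, A.curvDer i p (N.comp J) (e a) (J (e a)) = 0 := by
  -- `F(N J e, J e) = F(N e, e)` by invariance, and `F(e, N J J e) = -F(e, N e) = F(N e, e)`. This
  -- reduces the trace to the one for `N` itself.
  have h1 : ∀ a, A.curvDer i p (N.comp J) (e a) (J (e a)) =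
      A.curv i p (N (e a)) (e a) + A.curv i p (N (e a)) (e a) := fun a => by
    rw [curvDer_apply, ContinuousLinearMap.comp_apply, ContinuousLinearMap.comp_apply, hNJ,
      h i p hp, hJ, map_neg, map_neg, A.curv_swap i p (e a), neg_neg]
  simp only [h1, Finset.sum_add_distrib, sum_curv_W hN, add_zero]

theorem alpha_mem_kerDeformation [FiniteDimensional ℝ 𝔸] {M : E8 →L[ℝ] E8}
    (h1 : ∀ i, ∀ p ∈ A.U i, A.codiff (A.alpha M) i p = 0)
    (h2 : ∀ i, ∀ p ∈ A.U i, ∀ v, A.phiD (A.alpha M) i p v = 0) :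
    A.alpha M ∈ A.kerDeformation := by
  refine ⟨⟨A.alpha M, A.alpha_mem_Omega1 M⟩, ?_, rfl⟩
  refine LinearMap.mem_ker.mpr (Prod.ext ?_ ?_)
  · ext i p
    exact h1 i p p.2.1
  · ext i p v
    have h0 : A.cov0 (0 : A.Omega0) i p v = 0 := by
      have := A.cov0_smul 0 0 p.2.1 v
      simpa using this
    change A.cov0 (0 : A.Omega0) i p v + A.phiD (A.alpha M) i p v = 0
    rw [h0, h2 i p p.2.1, zero_add]

theorem kerDeformation_le_coulomb (A : ConicalConnection G ι) : A.kerDeformation ≤ A.coulomb := by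
  refine Submodule.map_mono fun α hα => ?_
  have h : (A.deformationOp ∘ₗ LinearMap.inr ℝ A.Omega0 A.Omega1) α = 0 := hα
  exact LinearMap.mem_ker.mpr (congrArg Prod.fst h)

/-- Each summand is treated separately. Every trace to be killed is against an `I_k` that
anticommutes with a structure preserving `curvDer`, except the trace against `I₁` on `W I₁` and
against `I₂` on `W I₂`; these two need `sum_curvDer_comp`. -/
theorem linearDeformations_le_kerDeformation [FiniteDimensional ℝ 𝔸] (h1 : A.CurvInvariant I₁)
    (h2 : A.CurvInvariant I₂) (h3 : A.CurvInvariant I₃) :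
    A.linearDeformations ≤ A.kerDeformation := by
  rw [linearDeformations, W₁₂, Submodule.map_le_iff_le_comap]
  have anti : ∀ {J K N : E8 →L[ℝ] E8}, (∀ u, N (J u) = J (N u)) → (∀ u, K (J u) = -J (K u)) →
      ∀ u, N.comp K (J u) = -J (N.comp K u) := fun hN hK u => by
    simp only [ContinuousLinearMap.comp_apply, hK, map_neg, hN]
  refine sup_le (sup_le ?_ ?_) ?_
  · intro M hM
    refine alpha_mem_kerDeformation (fun i p hp => codiff_alpha h1 h2 hp (sum_curv_W hM))
      fun i p hp v => ?_
    have c1 : ∀ u, M (I₁ u) = (1 : ℝ) • I₁ (M u) := by simpa using W_I₁ hM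
    have c2 : ∀ u, M (I₂ u) = (1 : ℝ) • I₂ (M u) := by simpa using W_I₂ hM
    have c3 : ∀ u, M (I₃ u) = (1 : ℝ) • I₃ (M u) := by simpa using W_I₃ hM
    have d1 := curvDer_invariant h1 hp c1
    have d2 := curvDer_invariant h2 hp c2
    simp only [one_smul] at d1 d2
    exact phiD_alpha h1 h2 h3 hp (by norm_num) c1 c2 c3
      (sum_eq_zero_of_anticomm inner_I₂ I₂_I₂ I₁_I₂' _ d2)
      (sum_eq_zero_of_anticomm inner_I₁ I₁_I₁ I₂_I₁' _ d1)
      (sum_eq_zero_of_anticomm inner_I₁ I₁_I₁ I₃_I₁ _ d1) v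
  · rintro _ ⟨N, hN, rfl⟩
    change A.alpha (N.comp I₁) ∈ A.kerDeformation
    have c1 : ∀ u, N.comp I₁ (I₁ u) = I₁ (N.comp I₁ u) := fun u => W_I₁ hN _
    have c2 := anti (W_I₂ hN) I₁_I₂'
    have c3 := anti (W_I₃ hN) I₁_I₃
    refine alpha_mem_kerDeformation (fun i p hp => codiff_alpha h1 h2 hp
      (sum_curv_anticomm h2 hp inner_I₂ I₂_I₂ c2)) fun i p hp v => ?_
    have c1' : ∀ u, N.comp I₁ (I₁ u) = (1 : ℝ) • I₁ (N.comp I₁ u) := by simpa using c1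
    have d1 := curvDer_invariant h1 hp c1'
    simp only [one_smul] at d1
    -- Signs `(1, -1, -1)`: `1 - 1 + 1 = 1`.
    exact phiD_alpha h1 h2 h3 hp (s₂ := -1) (s₃ := -1) (by norm_num) c1'
      (by simpa using c2) (by simpa using c3) (sum_curvDer_comp h1 hp hN I₁_I₁ (W_I₁ hN))
      (sum_eq_zero_of_anticomm inner_I₁ I₁_I₁ I₂_I₁' _ d1)
      (sum_eq_zero_of_anticomm inner_I₁ I₁_I₁ I₃_I₁ _ d1) v
  · rintro _ ⟨N, hN, rfl⟩
    change A.alpha (N.comp I₂) ∈ A.kerDeformation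
    have c1 := anti (W_I₁ hN) I₂_I₁'
    have c2 : ∀ u, N.comp I₂ (I₂ u) = I₂ (N.comp I₂ u) := fun u => W_I₂ hN _
    have c3 := anti (W_I₃ hN) I₂_I₃
    refine alpha_mem_kerDeformation (fun i p hp => codiff_alpha h1 h2 hp
      (sum_curv_anticomm h1 hp inner_I₁ I₁_I₁ c1)) fun i p hp v => ?_
    have c2' : ∀ u, N.comp I₂ (I₂ u) = (1 : ℝ) • I₂ (N.comp I₂ u) := by simpa using c2
    have d2 := curvDer_invariant h2 hp c2'
    simp only [one_smul] at d2
    -- Signs `(-1, 1, -1)`: `-1 + 1 + 1 = 1`.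
    exact phiD_alpha h1 h2 h3 hp (s₁ := -1) (s₃ := -1) (by norm_num)
      (by simpa using c1) c2' (by simpa using c3)
      (sum_eq_zero_of_anticomm inner_I₂ I₂_I₂ I₁_I₂' _ d2)
      (sum_curvDer_comp h2 hp hN I₂_I₂ (W_I₂ hN))
      (sum_eq_zero_of_anticomm inner_I₂ I₂_I₂ I₃_I₂ _ d2) v

end ConicalConnection

/-! ### Quaternionic lines and the parametrization of `W ⊕ W I₁ ⊕ W I₂`. -/

theorem rightMul_mem_of_forall_I {K : Submodule ℝ E8} (h1 : ∀ u ∈ K, I₁ u ∈ K)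
    (h2 : ∀ u ∈ K, I₂ u ∈ K) (h3 : ∀ u ∈ K, I₃ u ∈ K) {u : E8} (hu : u ∈ K) (q : ℍ) :
    rightMul q u ∈ K := by
  have : rightMul q u = q.re • u - q.imI • I₁ u - q.imJ • I₂ u - q.imK • I₃ u := by
    rw [I₁_eq, I₂_eq, I₃_eq]
    apply E8_ext <;> simp only [map_sub, map_smul, qx_rightMul, qy_rightMul] <;>
      ext <;> simp <;> ring
  rw [this]
  exact K.sub_mem (K.sub_mem (K.sub_mem (K.smul_mem _ hu) (K.smul_mem _ (h1 u hu)))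
    (K.smul_mem _ (h2 u hu))) (K.smul_mem _ (h3 u hu))

/-- A quaternionic polynomial that vanishes at `p` if and only if `M p` lies in the quaternionic
line through `p`, when the first component of `p` is not zero. -/
noncomputable def lineDefect (M : E8 →L[ℝ] E8) (p : E8) : ℍ :=
  Quaternion.normSq (qx p) • qy (M p) - qy p * star (qx p) * qx (M p)

/-- A quaternionic subspace of `ℍ²` that contains two independent vectors is everything. -/
theorem eq_top_of_lineDefect_ne_zero {K : Submodule ℝ E8}
    (hK : ∀ u ∈ K, ∀ q, rightMul q u ∈ K) {M : E8 →L[ℝ] E8} {p : E8} (hp : p ∈ K)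
    (hMp : M p ∈ K) (h : lineDefect M p ≠ 0) : K = ⊤ := by
  have hx : qx p ≠ 0 := by
    intro hx; apply h; simp [lineDefect, hx]
  -- Subtracting from `M p` the multiple of `p` with the same first component leaves `(0, w)`. The
  -- factor `|x|²` in `lineDefect` only clears the inverse of `x`, making it a polynomial.
  set w := qy (M p) - qy p * (qx p)⁻¹ * qx (M p) with hw
  have hn : Quaternion.normSq (qx p) ≠ 0 := Quaternion.normSq_ne_zero.mpr hx
  have hw0 : w ≠ 0 := by
    intro h0
    apply h
    have : lineDefect M p = Quaternion.normSq (qx p) • w := by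
      rw [lineDefect, hw, smul_sub, Quaternion.inv_def, mul_smul_comm, smul_mul_assoc, smul_smul,
        mul_inv_cancel₀ hn, one_smul]
    rw [this, h0, smul_zero]
  refine eq_top_iff.mpr fun v _ => ?_
  -- `p` is used to match the first component of `v`, then `(0, w)` to correct the second.
  have hv : v = rightMul ((qx p)⁻¹ * qx v) p + rightMul (w⁻¹ * (qy v - qy p * (qx p)⁻¹ * qx v))
      (M p - rightMul ((qx p)⁻¹ * qx (M p)) p) := by
    apply E8_ext
    · simp only [map_add, map_sub, qx_rightMul, mul_inv_cancel_left₀ hx, sub_self,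
        add_zero]
    · simp only [map_add, map_sub, qy_rightMul]
      rw [← mul_assoc (qy p), ← mul_assoc (qy p), ← sub_mul, ← hw, mul_inv_cancel_left₀ hw0,
        add_sub_cancel]
  rw [hv]
  exact K.add_mem (hK p hp _) (hK _ (K.sub_mem hMp (hK p hp _)) _)

theorem contDiff_lineDefect (M : E8 →L[ℝ] E8) : ContDiff ℝ ω (lineDefect M) := by
  have hre : ContDiff ℝ ω fun q : ℍ => Quaternion.normSq q := by
    have : (fun q : ℍ => Quaternion.normSq q) = fun q => inner ℝ q q := by
      ext q; rw [Quaternion.inner_self]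
    rw [this]
    exact contDiff_id.inner ℝ contDiff_id
  have hstar : ContDiff ℝ ω fun q : ℍ => star q :=
    (LinearMap.toContinuousLinearMap (⟨⟨star, star_add⟩, Quaternion.star_smul⟩ :
      ℍ →ₗ[ℝ] ℍ)).contDiff
  exact ((hre.comp qx.contDiff).smul (qy.contDiff.comp M.contDiff)).sub
    ((qy.contDiff.mul (hstar.comp qx.contDiff)).mul (qx.contDiff.comp M.contDiff))

/-- The zero set of `lineDefect` is nowhere dense unless it is everything. -/
theorem frequently_lineDefect_ne_zero {M : E8 →L[ℝ] E8} (h : ∃ p, lineDefect M p ≠ 0) (p : E8) :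
    ∃ᶠ q in nhds p, lineDefect M q ≠ 0 := by
  intro hev
  obtain ⟨p₁, hp₁⟩ := h
  have h0 : AnalyticOnNhd ℝ (lineDefect M) Set.univ :=
    contDiff_omega_iff_analyticOnNhd.mp (contDiff_lineDefect M)
  have := h0.eq_of_eventuallyEq (g := fun _ => 0) analyticOnNhd_const
    (z₀ := p) (by simpa [Filter.EventuallyEq] using hev)
  exact hp₁ (congrFun this p₁)

/-- The matrix with rows `(a, z̄)` and `(z, -a)`, as a linear function of `(a, z)`. -/
noncomputable def wMatrix : ℝ × ℍ →ₗ[ℝ] E8 →L[ℝ] E8 where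
  toFun s := quatMatrix (s.1 : ℍ) (star s.2) s.2 (-(s.1 : ℍ))
  map_add' s t := by
    ext1 p
    apply E8_ext <;> simp only [add_apply, map_add, qx_quatMatrix, qy_quatMatrix, Prod.fst_add,
      Prod.snd_add, Quaternion.coe_add, star_add] <;> noncomm_ring
  map_smul' c s := by
    ext1 p
    apply E8_ext <;> simp only [smul_apply, map_smul, qx_quatMatrix, qy_quatMatrix, Prod.smul_fst,
      Prod.smul_snd, Quaternion.star_smul, smul_mul_assoc, smul_add, RingHom.id_apply,
      smul_eq_mul, Quaternion.coe_mul, Quaternion.coe_mul_eq_smul, neg_mul, smul_neg]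

theorem wMatrix_apply (s : ℝ × ℍ) :
    wMatrix s = quatMatrix (s.1 : ℍ) (star s.2) s.2 (-(s.1 : ℍ)) := rfl

theorem range_wMatrix : LinearMap.range wMatrix = W := by
  ext M
  constructor
  · rintro ⟨s, rfl⟩; exact ⟨s.1, s.2, rfl⟩
  · rintro ⟨a, z, rfl⟩; exact ⟨(a, z), rfl⟩

/-- The parametrization of `W ⊕ W I₁ ⊕ W I₂` by three copies of `W`. -/
noncomputable def w₁₂Param : ((ℝ × ℍ) × (ℝ × ℍ)) × (ℝ × ℍ) →ₗ[ℝ] E8 →L[ℝ] E8 :=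
  (wMatrix.coprod (((ContinuousLinearMap.compL ℝ E8 E8 E8).flip I₁).toLinearMap ∘ₗ
    wMatrix)).coprod (((ContinuousLinearMap.compL ℝ E8 E8 E8).flip I₂).toLinearMap ∘ₗ wMatrix)

theorem range_w₁₂Param : LinearMap.range w₁₂Param = W₁₂ := by
  rw [w₁₂Param, LinearMap.range_coprod, LinearMap.range_coprod, LinearMap.range_comp,
    LinearMap.range_comp, range_wMatrix]
  rfl

theorem w₁₂Param_apply (s : ((ℝ × ℍ) × (ℝ × ℍ)) × (ℝ × ℍ)) (p : E8) : w₁₂Param s p =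
    wMatrix s.1.1 p + wMatrix s.1.2 (I₁ p) + wMatrix s.2 (I₂ p) := by
  simp [w₁₂Param]

/-- An endomorphism in `W ⊕ W I₁ ⊕ W I₂` that preserves all quaternionic lines vanishes, and so do
its three components. -/
theorem eq_zero_of_lineDefect_eq_zero {s : ((ℝ × ℍ) × (ℝ × ℍ)) × (ℝ × ℍ)}
    (h : ∀ p, lineDefect (w₁₂Param s) p = 0) : s = 0 := by
  have key : ∀ q : ℍ, s.1.1.2 - s.1.2.2 * qi - s.2.2 * qj
      - q * ((s.1.1.1 : ℍ) - s.1.2.1 * qi - s.2.1 * qj)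
      - ((s.1.1.1 : ℍ) * q - s.1.2.1 * q * qi - s.2.1 * q * qj)
      - q * (star s.1.1.2 * q - star s.1.2.2 * q * qi - star s.2.2 * q * qj) = 0 := by
    intro q
    -- Points `(1, q)` represent every quaternionic line except `x = 0`; there the defect is a
    -- quadratic polynomial in `q`.
    have := h (ofQuat (1, q))
    simp only [lineDefect, w₁₂Param_apply, wMatrix_apply, map_add, qx_quatMatrix, qy_quatMatrix,
      I₁_eq, I₂_eq, qx_rightMul, qy_rightMul, qx_ofQuat, qy_ofQuat, map_one, star_one,
      one_smul] at this
    rw [← this]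
    noncomm_ring
  obtain ⟨⟨⟨a₀, z₀⟩, ⟨a₁, z₁⟩⟩, ⟨a₂, z₂⟩⟩ := s
  -- Six values of `q` give 24 real linear equations, enough to determine the 15 real unknowns.
  have k0 := key 0
  have k1 := key 1
  have k2 := key (-1)
  have k3 := key qi
  have k5 := key qj
  have k7 := key qk
  simp only [Quaternion.ext_iff] at k0 k1 k2 k3 k5 k7
  simp at k0 k1 k2 k3 k5 k7
  obtain ⟨k01, k02, k03, k04⟩ := k0
  obtain ⟨k11, k12, k13, k14⟩ := k1
  obtain ⟨k21, k22, k23, k24⟩ := k2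
  obtain ⟨k31, k32, k33, k34⟩ := k3
  obtain ⟨k51, k52, k53, k54⟩ := k5
  obtain ⟨k71, k72, k73, k74⟩ := k7
  simp only [Prod.ext_iff, Quaternion.ext_iff]
  simp
  refine ⟨⟨⟨?_, ?_, ?_, ?_, ?_⟩, ?_, ?_, ?_, ?_, ?_⟩, ?_, ?_, ?_, ?_, ?_⟩ <;> linarith

/-- The skew-adjoint quaternionic matrix with rows `(0, -1)` and `(1, 0)` shows that `Lie(Sp(2))`
is not trivial. -/
theorem lieSp2_ne_bot : lieSp2 ≠ ⊥ := by
  intro h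
  have hcomm : ∀ q u, quatMatrix 0 (-1) 1 0 (rightMul q u) =
      rightMul q (quatMatrix 0 (-1) 1 0 u) := fun q u => by
    apply E8_ext <;>
      simp only [qx_rightMul, qy_rightMul, qx_quatMatrix, qy_quatMatrix, add_mul, mul_assoc]
  have hm : (fun u v => inner ℝ (quatMatrix 0 (-1) 1 0 u) v) ∈ lieSp2 := by
    refine ⟨quatMatrix 0 (-1) 1 0, ?_, ?_, ?_, ?_, rfl⟩
    · symm
      rw [ContinuousLinearMap.eq_adjoint_iff]
      intro u v
      simp only [neg_apply, inner_neg_left, inner_eq_re, qx_quatMatrix, qy_quatMatrix]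
      simp
    all_goals ext1 u; exact hcomm _ u
  rw [h, Submodule.mem_bot] at hm
  -- The matrix sends `(1, 0)` to `(0, 1)`, so the form takes the value one on this pair.
  have := congrFun (congrFun hm (ofQuat (1, 0))) (ofQuat (0, 1))
  simp [inner_eq_re, qx_quatMatrix, qy_quatMatrix, qx_ofQuat, qy_ofQuat] at this

/-! ### From the curvature hypothesis to invariance, injectivity and the dimension. -/

namespace ConicalConnection

variable {𝔸 : Type*} [NormedRing 𝔸] [NormedAlgebra ℝ 𝔸] {G : LinearLieGroup 𝔸} {ι : Type*}
  {A : ConicalConnection G ι}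

/-- For `m` commuting with the orthogonal `J`, `⟪m J u, J v⟫ = ⟪J m u, J v⟫ = ⟪m u, v⟫`. The
components of the curvature are scalar, so the identity is tested against all functionals on the
fibre. -/
theorem curvInvariant_of_le {J : E8 →L[ℝ] E8} (hJ : ∀ u v, inner ℝ (J u) v = inner ℝ u (-J v))
    (hJJ : ∀ u, J (J u) = -u)
    (hlie : ∀ η ∈ lieSp2, ∃ m : E8 →L[ℝ] E8, m.comp J = J.comp m ∧ η = fun u v => inner ℝ (m u) v)
    (h : Submodule.span ℝ A.curvatureComponents ≤ lieSp2) : A.CurvInvariant J := by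
  intro i p hp u v
  refine (SeparatingDual.eq_iff_forall_dual_eq (R := ℝ)).mpr fun l => ?_
  obtain ⟨m, hm, he⟩ := hlie _ (h (Submodule.subset_span ⟨i, p, hp, l, rfl⟩))
  have he' : ∀ u v, l (A.curv i p u v) = inner ℝ (m u) v := fun u v => by
    rw [curv_apply]; exact congrFun (congrFun he u) v
  have hm' : m (J u) = J (m u) := congrArg (fun f : E8 →L[ℝ] E8 => f u) hm
  rw [he', he', hm', hJ, hJJ, neg_neg]

theorem curvInvariant_I₁ (h : Submodule.span ℝ A.curvatureComponents ≤ lieSp2) :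
    A.CurvInvariant I₁ :=
  curvInvariant_of_le inner_I₁ I₁_I₁ (fun _ ⟨m, _, h1, _, _, h⟩ => ⟨m, h1, h⟩) h

theorem curvInvariant_I₂ (h : Submodule.span ℝ A.curvatureComponents ≤ lieSp2) :
    A.CurvInvariant I₂ :=
  curvInvariant_of_le inner_I₂ I₂_I₂ (fun _ ⟨m, _, _, h2, _, h⟩ => ⟨m, h2, h⟩) h

theorem curvInvariant_I₃ (h : Submodule.span ℝ A.curvatureComponents ≤ lieSp2) :
    A.CurvInvariant I₃ :=
  curvInvariant_of_le inner_I₃ I₃_I₃ (fun _ ⟨m, _, _, _, h3, h⟩ => ⟨m, h3, h⟩) h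

/-- Beyond the inclusion in `lieSp2`, all that is needed from the spanning hypothesis is that the
curvature does not vanish identically. -/
theorem exists_curv_ne_zero (h : Submodule.span ℝ A.curvatureComponents = lieSp2) :
    ∃ i, ∃ p ∈ A.U i, A.curv i p ≠ 0 := by
  by_contra! h0
  apply lieSp2_ne_bot
  rw [← h, Submodule.span_eq_bot]
  rintro _ ⟨i, p, hp, l, rfl⟩
  ext u v
  rw [← curv_apply, h0 i p hp]
  simp

theorem mem_ker_curv_of_mem {J : E8 →L[ℝ] E8} (h : A.CurvInvariant J) (hJJ : ∀ u, J (J u) = -u)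
    {i : ι} {p : E8} (hp : p ∈ A.U i) :
    ∀ u ∈ LinearMap.ker (A.curv i p).toLinearMap, J u ∈ LinearMap.ker (A.curv i p).toLinearMap := by
  intro u hu
  have hu' : A.curv i p u = 0 := hu
  refine LinearMap.mem_ker.mpr (ContinuousLinearMap.ext fun v => ?_)
  change A.curv i p (J u) v = 0
  -- `F(J u, v) = F(J u, J(-J v)) = F(u, -J v)`.
  have := h i p hp u (-J v)
  rwa [map_neg, hJJ, neg_neg, hu'] at this

/-- The map `M ↦ α_M` is injective on `W ⊕ W I₁ ⊕ W I₂`, if the curvature does not vanish. -/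
theorem eq_zero_of_alpha_eq_zero (h1 : A.CurvInvariant I₁) (h2 : A.CurvInvariant I₂)
    (h3 : A.CurvInvariant I₃) (hne : ∃ i, ∃ p ∈ A.U i, A.curv i p ≠ 0)
    {s : ((ℝ × ℍ) × (ℝ × ℍ)) × (ℝ × ℍ)} (hs : A.alpha (w₁₂Param s) = 0) : s = 0 := by
  refine eq_zero_of_lineDefect_eq_zero ?_
  by_contra! hM
  obtain ⟨i, p, hp, hF⟩ := hne
  have hcont : ContinuousAt (A.curv i) p := (A.differentiableAt_curv hp).continuousAt
  -- `F` stays nonzero near `p`, and points with nonzero defect accumulate at `p`, so some `q` has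
  -- both properties.
  have hfr := (frequently_lineDefect_ne_zero hM p).and_eventually
    ((A.eventually_mem hp).and (hcont.eventually_ne hF))
  obtain ⟨q, hq1, hq2, hq3⟩ := hfr.exists
  have htop : LinearMap.ker (A.curv i q).toLinearMap = ⊤ := by
    refine eq_top_of_lineDefect_ne_zero
      (fun u hu r => rightMul_mem_of_forall_I (mem_ker_curv_of_mem h1 I₁_I₁ hq2)
        (mem_ker_curv_of_mem h2 I₂_I₂ hq2) (mem_ker_curv_of_mem h3 I₃_I₃ hq2) hu r) ?_ ?_ hq1
    · exact LinearMap.mem_ker.mpr (ContinuousLinearMap.ext fun v => A.curv_self hq2 v)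
    · refine LinearMap.mem_ker.mpr (ContinuousLinearMap.ext fun v => ?_)
      change A.curv i q (w₁₂Param s q) v = 0
      rw [← A.alpha_apply hq2, hs]
      rfl
  exact hq3 (ContinuousLinearMap.coe_injective (LinearMap.ker_eq_top.mp htop))

/-- Injectivity is proved on three copies of `ℝ × ℍ` rather than on `W₁₂`, so directness of the sum
and the count `3 · (1 + 4)` come together. -/
theorem finrank_linearDeformations (h1 : A.CurvInvariant I₁) (h2 : A.CurvInvariant I₂)
    (h3 : A.CurvInvariant I₃) (hne : ∃ i, ∃ p ∈ A.U i, A.curv i p ≠ 0) :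
    Module.finrank ℝ A.linearDeformations = 15 := by
  have hinj : Function.Injective (A.alpha ∘ₗ w₁₂Param) := by
    rw [← LinearMap.ker_eq_bot, LinearMap.ker_eq_bot']
    exact fun s hs => eq_zero_of_alpha_eq_zero h1 h2 h3 hne hs
  rw [linearDeformations, ← range_w₁₂Param, ← LinearMap.range_comp,
    LinearMap.finrank_range_of_inj hinj]
  simp only [Module.finrank_prod, Module.finrank_self, Quaternion.finrank_eq_four]

/-- Stated with invariance and nonvanishing as hypotheses, so that it also serves the standard
instanton without computing the span of its curvature. -/
theorem linearDeformations_spec [FiniteDimensional ℝ 𝔸] (h1 : A.CurvInvariant I₁)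
    (h2 : A.CurvInvariant I₂) (h3 : A.CurvInvariant I₃)
    (hne : ∃ i, ∃ p ∈ A.U i, A.curv i p ≠ 0) :
    Module.finrank ℝ A.linearDeformations = 15 ∧ A.linearDeformations ≤ A.kerDeformation ∧
      A.linearDeformations ≤ A.coulomb :=
  have h := linearDeformations_le_kerDeformation h1 h2 h3
  ⟨finrank_linearDeformations h1 h2 h3 hne, h, h.trans A.kerDeformation_le_coulomb⟩

end ConicalConnection

/-! ### The curvature of the standard instanton. -/

/-- The curvature of the 1-form `stdAsdForm`. -/
noncomputable def asdCurv (q a b : ℍ × ℍ) : ℍ :=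
  fderiv ℝ stdAsdForm q a b - fderiv ℝ stdAsdForm q b a
    + (stdAsdForm q a * stdAsdForm q b - stdAsdForm q b * stdAsdForm q a)

/-- The imaginary part as a continuous linear map. -/
noncomputable def imCLM : ℍ →L[ℝ] ℍ := LinearMap.toContinuousLinearMap
  { toFun := Quaternion.im
    map_add' := fun a b => Quaternion.im_add a b
    map_smul' := fun t a => Quaternion.im_smul a t }

theorem imCLM_apply (q : ℍ) : imCLM q = Quaternion.im q := rfl

theorem differentiableAt_stdAsdForm {q : ℍ × ℍ} (hq : q ≠ 0) :
    DifferentiableAt ℝ stdAsdForm q :=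
  (contDiffOn_stdAsdForm.contDiffAt (isOpen_ne.mem_nhds hq)).differentiableAt (by simp)

theorem hasFDerivAt_normSq (q : ℍ) :
    HasFDerivAt (fun q : ℍ => Quaternion.normSq q) (2 • innerSL ℝ q) q := by
  have : (fun q : ℍ => Quaternion.normSq q) = fun q => ‖q‖ ^ 2 := by
    ext q; rw [Quaternion.normSq_eq_norm_mul_self, sq]
  rw [this]
  exact (hasStrictFDerivAt_norm_sq q).hasFDerivAt

theorem fderiv_stdAsdForm {q : ℍ × ℍ} (hq : q ≠ 0) (a b : ℍ × ℍ) :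
    fderiv ℝ stdAsdForm q a b =
      (Quaternion.normSq q.1 + Quaternion.normSq q.2)⁻¹ •
        Quaternion.im (a.1 * star b.1 + a.2 * star b.2) -
      (((Quaternion.normSq q.1 + Quaternion.normSq q.2) ^ 2)⁻¹ *
        (2 * (q.1 * star a.1 + q.2 * star a.2).re)) •
        Quaternion.im (q.1 * star b.1 + q.2 * star b.2) := by
  have h1 := (hasFDerivAt_normSq q.1).comp q (hasFDerivAt_fst (𝕜 := ℝ) (p := q))
  have h2 := (hasFDerivAt_normSq q.2).comp q (hasFDerivAt_snd (𝕜 := ℝ) (p := q))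
  have h3 := (hasDerivAt_inv (normSq_add_ne_zero hq)).comp_hasFDerivAt q (h1.add h2)
  have h4 := (hasFDerivAt_fst (𝕜 := ℝ) (p := q)).mul_const' (star b.1)
  have h5 := (hasFDerivAt_snd (𝕜 := ℝ) (p := q)).mul_const' (star b.2)
  have h6 := h3.smul (imCLM.hasFDerivAt.comp q (h4.add h5))
  rw [← fderiv_clm_apply_const (differentiableAt_stdAsdForm hq)]
  refine (congrArg (fun l => l a) h6.fderiv).trans ?_
  simp [imCLM_apply, Quaternion.inner_def]
  module

/-- Put `P = q ā` and `Q = q b̄`. Then `P̄ Q = |q|² a b̄`, and twice the imaginary part of `P̄ Q`,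
expanded into real and imaginary parts of `P` and `Q`, is the left side. -/
theorem im_bracket_identity (q a b : ℍ) :
    (2 * (q * star a).re) • Quaternion.im (q * star b)
      - (2 * (q * star b).re) • Quaternion.im (q * star a)
      - (Quaternion.im (q * star a) * Quaternion.im (q * star b)
        - Quaternion.im (q * star b) * Quaternion.im (q * star a)) =
    (2 * Quaternion.normSq q) • Quaternion.im (a * star b) := by
  ext <;> simp [Quaternion.normSq_def'] <;> ring

theorem im_mul_star_swap (a b : ℍ) : Quaternion.im (b * star a) = -Quaternion.im (a * star b) := by
  ext <;> simp <;> ring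

/-- Vectors in one factor suffice: over `{x ≠ 0}` the first component of the lift is constant. -/
theorem asdCurv_snd {q : ℍ × ℍ} (hq : q ≠ 0) (a b : ℍ) : asdCurv q (0, a) (0, b) =
    (((Quaternion.normSq q.1 + Quaternion.normSq q.2) ^ 2)⁻¹ * (2 * Quaternion.normSq q.1)) •
      Quaternion.im (a * star b) := by
  have hn := normSq_add_ne_zero hq
  have hi := im_bracket_identity q.2 a b
  simp only [asdCurv, fderiv_stdAsdForm hq, stdAsdForm_apply, star_zero, mul_zero, zero_add,
    im_mul_star_swap a b]
  generalize Quaternion.normSq q.1 = m at *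
  generalize Quaternion.normSq q.2 = n at *
  generalize Quaternion.im (q.2 * star a) = Y at *
  generalize Quaternion.im (q.2 * star b) = Z at *
  generalize Quaternion.im (a * star b) = X at *
  have hN : (m + n)⁻¹ = ((m + n) ^ 2)⁻¹ * (m + n) := by field_simp
  -- The part `2(m + n)` comes from the exterior derivative of the numerator; by
  -- `im_bracket_identity`, the derivative of the denominator and the commutator together account
  -- for `-2n`.
  have hX : (2 * m) • X = (2 * (m + n)) • X - (2 * n) • X := by module
  rw [mul_smul (((m + n) ^ 2)⁻¹) (2 * m) X, hX, ← hi, smul_mul_smul_comm, smul_mul_smul_comm]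
  rw [show (m + n)⁻¹ * (m + n)⁻¹ = ((m + n) ^ 2)⁻¹ by rw [sq, mul_inv], hN]
  module

theorem asdCurv_swap (q a b : ℍ × ℍ) (hq : q ≠ 0) :
    asdCurv q.swap a.swap b.swap = asdCurv q a b := by
  have hq' : q.swap ≠ 0 := fun h => hq (Prod.swap_injective h)
  simp only [asdCurv, fderiv_stdAsdForm hq, fderiv_stdAsdForm hq', stdAsdForm_apply,
    Prod.fst_swap, Prod.snd_swap, add_comm]

theorem asdCurv_fst {q : ℍ × ℍ} (hq : q ≠ 0) (a b : ℍ) : asdCurv q (a, 0) (b, 0) =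
    (((Quaternion.normSq q.2 + Quaternion.normSq q.1) ^ 2)⁻¹ * (2 * Quaternion.normSq q.2)) •
      Quaternion.im (a * star b) := by
  have hq' : q.swap ≠ 0 := fun h => hq (Prod.swap_injective h)
  rw [← asdCurv_swap q _ _ hq]
  exact asdCurv_snd hq' a b

/-- The derivative of the pullback of a 1-form. -/
theorem fderiv_pullback {E V X : Type*} [NormedAddCommGroup E] [NormedSpace ℝ E]
    [NormedAddCommGroup V] [NormedSpace ℝ V] [NormedAddCommGroup X] [NormedSpace ℝ X]
    {θ : V → V →L[ℝ] X} {σ : E → V} {p : E} (hθ : DifferentiableAt ℝ θ (σ p))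
    (hσ : DifferentiableAt ℝ σ p) (hσ' : DifferentiableAt ℝ (fderiv ℝ σ) p) (u v : E) :
    fderiv ℝ (fun q => (θ (σ q)).comp (fderiv ℝ σ q)) p u v =
      θ (σ p) (fderiv ℝ (fderiv ℝ σ) p u v) +
        fderiv ℝ θ (σ p) (fderiv ℝ σ p u) (fderiv ℝ σ p v) := by
  have h := (hθ.hasFDerivAt.comp p hσ.hasFDerivAt).clm_comp hσ'.hasFDerivAt
  exact congrArg (fun l => l u v) h.fderiv

/-- The curvature of the standard instanton is the pullback of `asdCurv` by the local lift. -/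
theorem stdInstanton_curv (i : Fin 3) {p : E8} (hp : p ∈ stdChart i) (u v : E8) :
    stdInstanton.curv i p u v =
      asdCurv (stdLift i p) (fderiv ℝ (stdLift i) p u) (fderiv ℝ (stdLift i) p v) := by
  have hs : ContDiffAt ℝ ∞ (stdLift i) p :=
    (contDiffOn_stdLift i).contDiffAt ((isOpen_stdChart i).mem_nhds hp)
  have hsymm : fderiv ℝ (fderiv ℝ (stdLift i)) p u v = fderiv ℝ (fderiv ℝ (stdLift i)) p v u :=
    (hs.isSymmSndFDerivAt
      (by rw [minSmoothness_of_isRCLikeNormedField]; exact ENat.LEInfty.out)).eq u v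
  have hD : DifferentiableAt ℝ (fderiv ℝ (stdLift i)) p :=
    (((contDiffOn_stdLift i).fderiv_of_isOpen (m := ∞) (isOpen_stdChart i) (by simp)).contDiffAt
      ((isOpen_stdChart i).mem_nhds hp)).differentiableAt (by simp)
  have key : ∀ u v, fderiv ℝ (stdA i) p u v =
      stdAsdForm (stdLift i p) (fderiv ℝ (fderiv ℝ (stdLift i)) p u v) +
      fderiv ℝ stdAsdForm (stdLift i p) (fderiv ℝ (stdLift i) p u)
        (fderiv ℝ (stdLift i) p v) := by
    intro u v
    exact fderiv_pullback (V := ℍ × ℍ) (differentiableAt_stdAsdForm (stdLift_ne_zero i hp))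
      (differentiableAt_stdLift i hp) hD u v
  rw [ConicalConnection.curv_apply, ConicalConnection.F]
  change fderiv ℝ (stdA i) p u v - fderiv ℝ (stdA i) p v u
    + (stdA i p u * stdA i p v - stdA i p v * stdA i p u) = _
  rw [key, key, hsymm, asdCurv]
  -- The second derivatives of the lift, made equal by symmetry, cancel.
  simp only [stdA, ContinuousLinearMap.comp_apply]
  abel

theorem fderiv_mul_inv {f g : E8 →L[ℝ] ℍ} {p : E8} (hg : g p ≠ 0)
    (hd : DifferentiableAt ℝ (fun q => f q * (g q)⁻¹) p) (u : E8) :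
    fderiv ℝ (fun q => f q * (g q)⁻¹) p u = (f u - f p * (g p)⁻¹ * g u) * (g p)⁻¹ := by
  have h := hd.hasFDerivAt.mul' g.hasFDerivAt
  -- The product rule for `(f g⁻¹) g = f` yields the derivative without differentiating an inverse.
  have hev : (fun q => f q * (g q)⁻¹ * g q) =ᶠ[nhds p] f := by
    filter_upwards [g.continuous.continuousAt.eventually_ne hg] with q hq
    rw [inv_mul_cancel_right₀ hq]
  have h1 := congrArg (fun l => l u)
    ((h.congr_of_eventuallyEq hev.symm).unique f.hasFDerivAt)
  simp at h1
  rw [← h1, add_sub_cancel_left, mul_inv_cancel_right₀ hg]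

theorem fderiv_stdLift_one {p : E8} (hp : p ∈ stdChart 1) (u : E8) : fderiv ℝ (stdLift 1) p u =
    (0, (qy u - qy p * (qx p)⁻¹ * qx u) * (qx p)⁻¹) := by
  have hd := differentiableAt_stdLift 1 hp
  have h2 : DifferentiableAt ℝ (fun q => qy q * (qx q)⁻¹) p := hd.snd
  rw [← fderiv_mul_inv hp h2]
  exact congrArg (fun l => l u)
    ((hasFDerivAt_const (1 : ℍ) p).prodMk h2.hasFDerivAt).fderiv

theorem fderiv_stdLift_two {p : E8} (hp : p ∈ stdChart 2) (u : E8) : fderiv ℝ (stdLift 2) p u =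
    ((qx u - qx p * (qy p)⁻¹ * qy u) * (qy p)⁻¹, 0) := by
  have hd := differentiableAt_stdLift 2 hp
  have h2 : DifferentiableAt ℝ (fun q => qx q * (qy q)⁻¹) p := hd.fst
  rw [← fderiv_mul_inv hp h2]
  exact congrArg (fun l => l u)
    (h2.hasFDerivAt.prodMk (hasFDerivAt_const (1 : ℍ) p)).fderiv

/-- `x⁻¹` times its conjugate is real and moves out of the middle, after which `r r̄ = 1` cancels.
-/
theorem im_mul_inv_mul_star {r x : ℍ} (hr : Quaternion.normSq r = 1) (a b : ℍ) :
    Quaternion.im (a * r * x⁻¹ * star (b * r * x⁻¹)) =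
      Quaternion.im (a * x⁻¹ * star (b * x⁻¹)) := by
  have h : ∀ s t : ℍ, s * x⁻¹ * star (t * x⁻¹) = (Quaternion.normSq x)⁻¹ • (s * star t) := by
    intro s t
    rw [star_mul, mul_assoc, ← mul_assoc x⁻¹, Quaternion.self_mul_star, map_inv₀,
      Quaternion.coe_mul_eq_smul, mul_smul_comm]
  rw [h, h, star_mul, mul_assoc a, ← mul_assoc r, Quaternion.self_mul_star, hr,
    Quaternion.coe_one, one_mul]

theorem stdInstanton_curvInvariant {r : ℍ} (hr : Quaternion.normSq r = 1) :
    stdInstanton.CurvInvariant (rightMul r) := by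
  have h1 : ∀ p ∈ stdChart 1, ∀ u v, stdInstanton.curv 1 p (rightMul r u) (rightMul r v) =
      stdInstanton.curv 1 p u v := by
    intro p hp u v
    simp only [stdInstanton_curv 1 hp, fderiv_stdLift_one hp, asdCurv_snd (stdLift_ne_zero 1 hp),
      qx_rightMul, qy_rightMul, ← mul_assoc, ← sub_mul, im_mul_inv_mul_star hr]
  intro i p hp u v
  fin_cases i
  -- The chart `{x ≠ 0, y ≠ 0}` lies in `{x ≠ 0}`, and invariance is unaffected by conjugation.
  · have hp' : p ∈ stdInstanton.U 0 ∩ stdInstanton.U 1 := ⟨hp, hp.1⟩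
    change stdInstanton.curv 0 p _ _ = stdInstanton.curv 0 p _ _
    rw [stdInstanton.curv_gauge hp', stdInstanton.curv_gauge hp', h1 p hp.1]
  · exact h1 p hp u v
  · have hp' : p ∈ stdChart 2 := hp
    change stdInstanton.curv 2 p _ _ = stdInstanton.curv 2 p _ _
    simp only [stdInstanton_curv 2 hp', fderiv_stdLift_two hp',
      asdCurv_fst (stdLift_ne_zero 2 hp'), qx_rightMul, qy_rightMul, ← mul_assoc, ← sub_mul,
      im_mul_inv_mul_star hr]

theorem stdInstanton_curv_ne_zero : ∃ i, ∃ p ∈ stdInstanton.U i, stdInstanton.curv i p ≠ 0 := by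
  have hp : ofQuat (1, 0) ∈ stdChart 1 := by
    change qx _ ≠ 0
    rw [qx_ofQuat]; exact one_ne_zero
  -- At `(1, 0)` the lift is `(1, 0)`, and the curvature on `(0, 1)`, `(0, i)` is `2 Im(1 · ī) =
  -- -2i`.
  refine ⟨1, ofQuat (1, 0), hp, fun h => ?_⟩
  have h0 : stdInstanton.curv 1 (ofQuat (1, 0)) (ofQuat (0, 1)) (ofQuat (0, qi)) = 0 := by
    rw [h]; rfl
  rw [stdInstanton_curv 1 hp, fderiv_stdLift_one hp, fderiv_stdLift_one hp,
    asdCurv_snd (stdLift_ne_zero 1 hp)] at h0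
  have h1 := congrArg (fun q : ℍ => q.imI) h0
  simp [stdLift, qx_ofQuat, qy_ofQuat] at h1

end G2Inst

theorem proposition3 :
    (∀ (𝔸 : Type*) [NormedRing 𝔸] [NormedAlgebra ℝ 𝔸] [FiniteDimensional ℝ 𝔸]
      (G : G2Inst.LinearLieGroup 𝔸) (ι : Type*) (A : G2Inst.ConicalConnection G ι),
      Submodule.span ℝ A.curvatureComponents = G2Inst.lieSp2 →
        Module.finrank ℝ A.linearDeformations = 15 ∧
        A.linearDeformations ≤ A.kerDeformation ∧
        A.linearDeformations ≤ A.coulomb) ∧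
    (Module.finrank ℝ G2Inst.stdInstanton.linearDeformations = 15 ∧
      G2Inst.stdInstanton.linearDeformations ≤ G2Inst.stdInstanton.kerDeformation ∧
      G2Inst.stdInstanton.linearDeformations ≤ G2Inst.stdInstanton.coulomb) := by
  open G2Inst ConicalConnection in
  refine ⟨fun 𝔸 _ _ _ G ι A h => linearDeformations_spec (curvInvariant_I₁ h.le)
    (curvInvariant_I₂ h.le) (curvInvariant_I₃ h.le) (exists_curv_ne_zero h),
    linearDeformations_spec ?_ ?_ ?_ stdInstanton_curv_ne_zero⟩
  · rw [I₁_eq]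
    exact stdInstanton_curvInvariant (by simp [Quaternion.normSq_def'])
  · rw [G2Inst.I₂_eq]
    exact G2Inst.stdInstanton_curvInvariant (by simp [Quaternion.normSq_def'])
  · rw [G2Inst.I₃_eq]
    exact G2Inst.stdInstanton_curvInvariant (by simp [Quaternion.normSq_def'])
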